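/- **Setting.** An $H^1$-regular state on fermionic Fock space over $L^2(\mathbb R^3;\mathbb C)$ is $\Gamma=\Gamma_0\oplus\Gamma_1\oplus\dots$, where $\Gamma_n=\sum_j\mu_{n,j}|\Psi_{n,j}\rangle\langle\Psi_{n,j}|$ is a nonnegative trace class operator on the antisymmetric part of $L^2(\mathbb R^{3n};\mathbb C)$ (equal to $\mathbb C$ for $n=0$), with $\mu_{n,j}\ge0$, $\sum_{n,j}\mu_{n,j}=1$, $\{\Psi_{n,j}\}_j\subset H^1(\mathbb R^{3n})$ orthonormal, and finite kinetic energy $\mathcal T(\Gamma)=\sum_{n,j}\mu_{n,j}\|\nabla\Psi_{n,j}\|^2<\infty$. Its Coulomb energy is $\mathcal C(\Gamma)=\sum_{n,j}\mu_{n,j}\sum_{a<b}\int\frac{|\Psi_{n,j}|^2}{|\mathbf x_a-\mathbf x_b|}$, its density and paramagnetic current density are $$\rho_\Gamma(\mathbf x)=\sum_{n\ge1}n\sum_j\mu_{n,j}\int|\Psi_{n,j}(\mathbf x,\mathbf Y)|^2\,d\mathbf Y,\qquad \mathbf j_\Gamma(\mathbf x)=\operatorname{Im}\sum_{n\ge1}n\sum_j\mu_{n,j}\int\nabla_{\mathbf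 x}\Psi_{n,j}(\mathbf x,\mathbf Y)\,\overline{\Psi_{n,j}(\mathbf x,\mathbf Y)}\,d\mathbf Y,$$ with $\mathbf Y\in\mathbb R^{3(n-1)}$. For $\rho\ge 0$ and $\mathbf j:\mathbb R^3\to\mathbb R^3$ let $$F(\rho,\mathbf j)=\inf_{\rho_\Gamma=\rho,\ \mathbf j_\Gamma=\mathbf j}\big(\mathcal T(\Gamma)+\mathcal C(\Gamma)\big),\qquad T(\rho,\mathbf j)=\inf_{\rho_\Gamma=\rho,\ \mathbf j_\Gamma=\mathbf j}\mathcal T(\Gamma)$$ (equalities almost everywhere, $\inf\emptyset=+\infty$, all functionals extended-real valued), $E(\rho,\mathbf j)=F(\rho,\mathbf j)-\frac12\iint\frac{\rho(\mathbf x)\rho(\mathbf y)}{|\mathbf x-\mathbf y|}\,d\mathbf x\,d\mathbf y$, $\overline E(\rho,\mathbf j)=E(\rho,\mathbf j)-\int\frac{|\mathbf j|^2}{\rho}$ and $\overline T(\rho,\mathbf j)=T(\rho,\mathbf j)-\int\frac{|\mathbf j|^2}{\rho}$. For a bounded nonempty open $\Omega\subset\mathbb R^3$, a function $\eta\ge0$,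 $\rho_0\ge0$ and $\nu_0\in\mathbb R^3$ put $$e_{\Omega,\eta}(\rho_0,\nu_0)=\frac1{|\Omega|}\overline E\big((\mathbb 1_\Omega*\eta)(\rho_0,\tfrac12\rho_0\,\nu_0\times\cdot)\big),\quad \tau_{\Omega,\eta}(\rho_0,\nu_0)=\frac1{|\Omega|}\overline T\big((\mathbb 1_\Omega*\eta)(\rho_0,\tfrac12\rho_0\,\nu_0\times\cdot)\big),$$ and $e^{\mathrm{xc}}_{\Omega,\eta}=e_{\Omega,\eta}-\tau_{\Omega,\eta}$. A regularization function is an $\eta\in C_c^\infty(\mathbb R^3)$ with $\eta\ge0$, $\operatorname{supp}\eta\subset B_1$, $\int\mathbf x\,\eta(\mathbf x)\,d\mathbf x=0$ and $\int\eta=1$; for $\delta>0$ let $\eta_\delta(\mathbf x)=\delta^{-3}\eta(\delta^{-1}\mathbf x)$. **Lemma.** Let $\rho_0\ge0$, $\nu_0\in\mathbb R^3$, $R\in\mathrm O(3)$, $\mathbf a\in\mathbb R^3$ and $\mathbf T(\mathbf x)=R\mathbf x+\mathbf a$. Let $\Omega\subset\mathbb R^3$ be a bounded nonempty open set with barycenter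 $0$, let $\eta$ be a regularization function and $\delta>0$. Then: (i) $$E\big((\mathbb 1_{\mathbf T^{-1}(\Omega)}*(\eta_\delta\circ R))(\rho_0,\tfrac12\rho_0\,\nu_0\times\cdot)\big)=E\big((\mathbb 1_\Omega*\eta_\delta)(\rho_0,\tfrac12\rho_0\,R\nu_0\times\cdot)\big)+\frac{\rho_0}4|R\nu_0\times\mathbf a|^2\int_{\mathbb R^3}(\mathbb 1_\Omega*\eta_\delta),$$ and the same relation holds with $E$ replaced by $T$. (ii) $e_{\mathbf T^{-1}(\Omega),\eta_\delta\circ R}(\rho_0,\nu_0)=e_{\Omega,\eta_\delta}(\rho_0,R\nu_0)$, $\tau_{\mathbf T^{-1}(\Omega),\eta_\delta\circ R}(\rho_0,\nu_0)=\tau_{\Omega,\eta_\delta}(\rho_0,R\nu_0)$ and $e^{\mathrm{xc}}_{\mathbf T^{-1}(\Omega),\eta_\delta\circ R}(\rho_0,\nu_0)=e^{\mathrm{xc}}_{\Omega,\eta_\delta}(\rho_0,R\nu_0)$. -/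

import Mathlib

open MeasureTheory
open scoped ENNReal ContDiff

noncomputable section

namespace MagneticUEG

/-! ### Fermionic wave functions -/

/-- Physical space `ℝ³` with the Euclidean norm. -/
abbrev E3 : Type := EuclideanSpace ℝ (Fin 3)

/-- Configurations `X = (x₁, …, xₙ)` of `n` particles, with Lebesgue measure.
For `n = 0` this is one point of mass one, so that `L²` of it is `ℂ`. -/
abbrev Config (n : ℕ) : Type := Fin n → E3

theorem measurePreserving_perm {n : ℕ} (σ : Equiv.Perm (Fin n)) :
    MeasurePreserving (fun X : Config n => X ∘ σ) volume volume := by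
  have h := volume_measurePreserving_piCongrLeft (fun _ : Fin n => E3) σ.symm
  convert h using 1
  funext X
  ext i
  simp [MeasurableEquiv.piCongrLeft, Equiv.piCongrLeft, Equiv.piCongrLeft']

/-- The `n`-particle fermionic Hilbert space: the antisymmetric elements of `L²(ℝ³ⁿ; ℂ)`. -/
def Fermion (n : ℕ) : Submodule ℂ (Lp ℂ 2 (volume : Measure (Config n))) where
  carrier := {Ψ | ∀ σ : Equiv.Perm (Fin n),
    ∀ᵐ X : Config n, Ψ (X ∘ σ) = ((Equiv.Perm.sign σ : ℤ) : ℂ) * Ψ X}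
  zero_mem' := by
    intro σ
    have h0 := Lp.coeFn_zero ℂ 2 (volume : Measure (Config n))
    filter_upwards [h0, (measurePreserving_perm σ).quasiMeasurePreserving.ae h0] with X h1 h2
    rw [h1, h2]
    simp
  add_mem' := by
    intro Ψ Φ hΨ hΦ σ
    have h0 := Lp.coeFn_add Ψ Φ
    filter_upwards [h0, (measurePreserving_perm σ).quasiMeasurePreserving.ae h0, hΨ σ, hΦ σ]
      with X h1 h2 h3 h4
    rw [h1, h2, Pi.add_apply, Pi.add_apply, h3, h4]
    ring
  smul_mem' := by
    intro c Ψ hΨ σ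
    have h0 := Lp.coeFn_smul c Ψ
    filter_upwards [h0, (measurePreserving_perm σ).quasiMeasurePreserving.ae h0, hΨ σ]
      with X h1 h2 h3
    rw [h1, h2, Pi.smul_apply, Pi.smul_apply, h3]
    simp only [smul_eq_mul]
    ring

/-- A wave function as a function of the configuration. -/
def wave {n : ℕ} (Ψ : Fermion n) : Config n → ℂ :=
  ((Ψ : Lp ℂ 2 (volume : Measure (Config n))) : Config n → ℂ)

/-- The unit vector of `ℝ³ⁿ` in the `k`-th coordinate of the `i`-th particle. -/
def unitVec {n : ℕ} (i : Fin n) (k : Fin 3) : Config n :=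
  Pi.single i (EuclideanSpace.single k 1)

/-- `g` is the weak derivative of `f` in the `k`-th coordinate of the `i`-th particle. -/
def IsWeakPartial {n : ℕ} (f g : Config n → ℂ) (i : Fin n) (k : Fin 3) : Prop :=
  ∀ φ : Config n → ℝ, ContDiff ℝ ∞ φ → HasCompactSupport φ →
    ∫ X, (fderiv ℝ φ X (unitVec i k)) • f X = -∫ X, φ X • g X

/-- `Ψ ∈ H¹(ℝ³ⁿ)`: all first order weak derivatives are square integrable. -/
def MemH1 {n : ℕ} (Ψ : Fermion n) : Prop :=
  ∀ (i : Fin n) (k : Fin 3), ∃ g : Config n → ℂ, MemLp g 2 volume ∧ IsWeakPartial (wave Ψ) g i k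

open Classical in
/-- The square integrable weak derivative of `Ψ` in the `k`-th coordinate of the `i`-th particle
(unique almost everywhere; it exists for `Ψ ∈ H¹`). -/
def weakPartial {n : ℕ} (Ψ : Fermion n) (i : Fin n) (k : Fin 3) : Config n → ℂ :=
  if h : ∃ g : Config n → ℂ, MemLp g 2 volume ∧ IsWeakPartial (wave Ψ) g i k then h.choose else 0

/-- `‖∇Ψ‖²`, the quadratic form of `-∑ᵢ Δ_{xᵢ}` on `H¹`. -/
def kineticForm {n : ℕ} (Ψ : Fermion n) : ℝ≥0∞ :=
  ∑ i : Fin n, ∑ k : Fin 3, ∫⁻ X, ‖weakPartial Ψ i k X‖ₑ ^ 2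

/-- The quadratic form of `∑_{a<b} 1/|x_a - x_b|`. -/
def coulombForm {n : ℕ} (Ψ : Fermion n) : ℝ≥0∞ :=
  ∑ a : Fin n, ∑ b ∈ Finset.Ioi a, ∫⁻ X, ‖wave Ψ X‖ₑ ^ 2 / edist (X a) (X b)

/-! ### States on Fock space -/

/-- An `H¹`-regular block-diagonal state `Γ = Γ₀ ⊕ Γ₁ ⊕ …` on fermionic Fock space: every block is
a nonnegative trace class operator `Γₙ = ∑ⱼ μₙⱼ |Ψₙⱼ⟩⟨Ψₙⱼ|`, the traces add up to one, and the
total kinetic energy is finite.  The state is given together with a diagonalisation of its blocks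
(every nonnegative trace class operator has one, and the traces and the densities below depend on
`Γ` only).  Only the wave functions of nonzero weight matter; they are orthonormal. -/
structure FockState where
  /-- the operator `Γₙ` on the `n`-particle space -/
  block : ∀ n : ℕ, Fermion n →L[ℂ] Fermion n
  /-- the eigenvalues `μₙⱼ` -/
  weight : ℕ → ℕ → ℝ
  /-- the eigenfunctions `Ψₙⱼ` -/
  orbital : ∀ n : ℕ, ℕ → Fermion n
  weight_nonneg : ∀ n j, 0 ≤ weight n j
  orthonormal : ∀ n, Orthonormal ℂ (fun j : {j : ℕ // weight n j ≠ 0} => orbital n j)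
  spectral : ∀ (n : ℕ) (Φ : Fermion n),
    HasSum (fun j => ((weight n j : ℂ) * inner ℂ (orbital n j) Φ) • orbital n j) (block n Φ)
  trace_eq_one : HasSum (fun p : ℕ × ℕ => weight p.1 p.2) 1
  memH1 : ∀ n j, MemH1 (orbital n j)
  kinetic_ne_top : ∑' n, ∑' j, ENNReal.ofReal (weight n j) * kineticForm (orbital n j) ≠ ⊤

/-- The kinetic energy `∑ₙ Tr(-∑ᵢ Δ_{xᵢ} Γₙ)`. -/
def FockState.kinetic (Γ : FockState) : ℝ≥0∞ :=
  ∑' n, ∑' j, ENNReal.ofReal (Γ.weight n j) * kineticForm (Γ.orbital n j)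

/-- The Coulomb energy `∑ₙ Tr(∑_{a<b} |x_a - x_b|⁻¹ Γₙ)`. -/
def FockState.coulomb (Γ : FockState) : ℝ≥0∞ :=
  ∑' n, ∑' j, ENNReal.ofReal (Γ.weight n j) * coulombForm (Γ.orbital n j)

/-- The density `ρ_Γ(x) = γ_Γ(x, x)`, where
`γ_Γ(x, y) = ∑_{N ≥ 1} N ∫ Γ_N(x, x₂, …, x_N; y, x₂, …, x_N) dx₂ ⋯ dx_N`; here `N = n + 1`. -/
def FockState.density (Γ : FockState) (x : E3) : ℝ≥0∞ :=
  ∑' n : ℕ, ∑' j : ℕ, ENNReal.ofReal (Γ.weight (n + 1) j) * ((n + 1 : ℕ) : ℝ≥0∞) *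
    ∫⁻ Y : Config n, ‖wave (Γ.orbital (n + 1) j) (Matrix.vecCons x Y)‖ₑ ^ 2

/-- The paramagnetic current density `j_Γ(x) = Im ∇ₓ γ_Γ(x, y)|_{y = x}`. -/
def FockState.current (Γ : FockState) (x : E3) : E3 :=
  WithLp.toLp 2 fun k : Fin 3 =>
    ∑' n : ℕ, ∑' j : ℕ, Γ.weight (n + 1) j * ((n + 1 : ℕ) : ℝ) *
      (∫ Y : Config n, weakPartial (Γ.orbital (n + 1) j) 0 k (Matrix.vecCons x Y) *
        starRingEnd ℂ (wave (Γ.orbital (n + 1) j) (Matrix.vecCons x Y))).im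

/-- The state `Γ` has density `ρ` and paramagnetic current density `jp` (almost everywhere). -/
def FockState.Represents (Γ : FockState) (ρ : E3 → ℝ) (jp : E3 → E3) : Prop :=
  (∀ᵐ x, Γ.density x = ENNReal.ofReal (ρ x)) ∧ (∀ᵐ x, Γ.current x = jp x)

/-! ### Current-density functionals

They take values in the extended reals; an infimum over no state is `+∞`. -/

/-- The grand-canonical Vignale–Rasolt functional `F(ρ, jp)`. -/
def vignaleRasolt (ρ : E3 → ℝ) (jp : E3 → E3) : ℝ≥0∞ :=
  ⨅ (Γ : FockState) (_ : Γ.Represents ρ jp), Γ.kinetic + Γ.coulomb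

/-- The kinetic energy functional `T(ρ, jp)`. -/
def kineticEnergy (ρ : E3 → ℝ) (jp : E3 → E3) : EReal :=
  ((⨅ (Γ : FockState) (_ : Γ.Represents ρ jp), Γ.kinetic : ℝ≥0∞) : EReal)

/-- The direct energy `D(ρ) = ½ ∬ ρ(x) ρ(y) / |x - y| dx dy` of a density `ρ ≥ 0`. -/
def directEnergy (ρ : E3 → ℝ) : ℝ≥0∞ :=
  (∫⁻ x, ∫⁻ y, ENNReal.ofReal (ρ x) * ENNReal.ofReal (ρ y) / edist x y) / 2

/-- The indirect energy `E(ρ, jp) = F(ρ, jp) - D(ρ)`. -/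
def indirectEnergy (ρ : E3 → ℝ) (jp : E3 → E3) : EReal :=
  (vignaleRasolt ρ jp : EReal) - (directEnergy ρ : EReal)

/-- The gauge term `∫ |jp|² / ρ`; the integrand is `0` where `ρ` and `jp` both vanish, and `+∞`
where only `ρ` does. -/
def gaugeTerm (ρ : E3 → ℝ) (jp : E3 → E3) : ℝ≥0∞ :=
  ∫⁻ x, ‖jp x‖ₑ ^ 2 / ENNReal.ofReal (ρ x)

/-- The gauge-corrected indirect energy. -/
def gaugeCorrectedEnergy (ρ : E3 → ℝ) (jp : E3 → E3) : EReal :=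
  indirectEnergy ρ jp - (gaugeTerm ρ jp : EReal)

/-- The gauge-corrected kinetic energy. -/
def gaugeCorrectedKinetic (ρ : E3 → ℝ) (jp : E3 → E3) : EReal :=
  kineticEnergy ρ jp - (gaugeTerm ρ jp : EReal)

/-! ### The electron gas of constant density and vorticity in a smeared domain -/

/-- The cross product on `ℝ³`. -/
def cross (u v : E3) : E3 := WithLp.toLp 2 (crossProduct u.ofLp v.ofLp)

/-- Regularization functions: `0 ≤ η ∈ C_c^∞(ℝ³)`, `supp η ⊆ B₁`, `∫ x η(x) dx = 0`, `∫ η = 1`. -/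
structure IsRegularization (η : E3 → ℝ) : Prop where
  nonneg : ∀ x, 0 ≤ η x
  contDiff : ContDiff ℝ ∞ η
  hasCompactSupport : HasCompactSupport η
  support_subset : tsupport η ⊆ Metric.ball 0 1
  barycenter : ∫ x, η x • x = 0
  integral_eq_one : ∫ x, η x = 1

/-- `η_δ(x) = δ⁻³ η(δ⁻¹ x)`. -/
def rescale (η : E3 → ℝ) (δ : ℝ) : E3 → ℝ := fun x => (δ ^ 3)⁻¹ * η (δ⁻¹ • x)

/-- The smeared indicator function `𝟙_Ω * η`. -/
def smeared (Ω : Set E3) (η : E3 → ℝ) : E3 → ℝ :=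
  convolution (Ω.indicator fun _ => (1 : ℝ)) η (ContinuousLinearMap.lsmul ℝ ℝ) volume

/-- The density `(𝟙_Ω * η) ρ₀`. -/
def uegDensity (Ω : Set E3) (η : E3 → ℝ) (ρ₀ : ℝ) : E3 → ℝ :=
  fun x => smeared Ω η x * ρ₀

/-- The symmetric-gauge current density `(𝟙_Ω * η)(x) ½ ρ₀ ν₀ × x`. -/
def uegCurrent (Ω : Set E3) (η : E3 → ℝ) (ρ₀ : ℝ) (ν₀ : E3) : E3 → E3 :=
  fun x => smeared Ω η x • ((ρ₀ / 2) • cross ν₀ x)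

/-- The indirect gauge-corrected energy per volume `e_{Ω,η}(ρ₀, ν₀)`. -/
def energyPerVolume (Ω : Set E3) (η : E3 → ℝ) (ρ₀ : ℝ) (ν₀ : E3) : EReal :=
  gaugeCorrectedEnergy (uegDensity Ω η ρ₀) (uegCurrent Ω η ρ₀ ν₀) / (volume Ω : EReal)

/-- The kinetic energy per volume `τ_{Ω,η}(ρ₀, ν₀)`. -/
def kineticPerVolume (Ω : Set E3) (η : E3 → ℝ) (ρ₀ : ℝ) (ν₀ : E3) : EReal :=
  gaugeCorrectedKinetic (uegDensity Ω η ρ₀) (uegCurrent Ω η ρ₀ ν₀) / (volume Ω : EReal)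

/-- The exchange-correlation energy per volume `e^xc = e - τ`. -/
def xcPerVolume (Ω : Set E3) (η : E3 → ℝ) (ρ₀ : ℝ) (ν₀ : E3) : EReal :=
  energyPerVolume Ω η ρ₀ ν₀ - kineticPerVolume Ω η ρ₀ ν₀

end MagneticUEG

end

open MagneticUEG

open MeasureTheory
open scoped ENNReal ContDiff

noncomputable section

namespace MagneticUEG

/-! A Euclidean motion acts on wave functions by Ψ ↦ Ψ(Rx₁ + a, …, Rxₙ + a). Two further operations
are needed to match the currents. The cross product is a pseudovector operation, `cross_rot`: Rν₀ ×
(Rx + a) = det R · R(ν₀ × x) + Rν₀ × a. The factor det R = -1 of an improper R is supplied by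
complex conjugation of Ψ, which reverses currents. The constant vector Rν₀ × a is removed by a phase
exp(i ∑ⱼ ⟨κ, xⱼ⟩), which adds κρ to the current; this forces κ = -½ det R · R⁻¹(Rν₀ × a).

The combined operation is unitary or antiunitary. It preserves antisymmetry and the Coulomb energy,
and it moves the density along with the motion. Expanding |∇(e^{iκ·x}Ψ)|² shows that the kinetic
energy changes by 2⟨κ, ± R⁻¹∫j⟩ + |κ|²∫ρ (`toReal_kinetic_map`). This number depends on (ρ, j) only,
and the operation can be inverted, so the constrained infima change by exactly this number
(`iInf_map`); the direct energy does not change. The barycenter of 𝟙_Ω * η_δ is 0 and j is linear in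
x, hence ∫j = 0. What remains is |κ|²∫ρ = (ρ₀/4)|Rν₀ × a|²∫(𝟙_Ω * η_δ), which is (i).

For (ii), the gauge term is a second moment of the smeared domain. By the parallel axis theorem
(`gaugeTerm_integral_sub`) the motion changes it by the same constant, so the two changes cancel.

The analytic work lies in weak derivatives of transformed functions, in Fubini on almost every
slice, and in the absolute convergence of the series for the current. That convergence, and the
finiteness of the boosted kinetic energy, rest on ∫ρ < ∞. -/

/-! ### Weak directional derivatives -/

/-- `g` is the weak derivative of `f` in the direction `v`. -/
def IsWeakDeriv {n : ℕ} (f g : Config n → ℂ) (v : Config n) : Prop :=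
  ∀ φ : Config n → ℝ, ContDiff ℝ ∞ φ → HasCompactSupport φ →
    ∫ X, (fderiv ℝ φ X v) • f X = -∫ X, φ X • g X

theorem integrable_test_smul {n : ℕ} {f : Config n → ℂ} (hf : LocallyIntegrable f)
    {φ : Config n → ℝ} (hφ : Continuous φ) (hc : HasCompactSupport φ) :
    Integrable (fun X => φ X • f X) :=
  hf.integrable_smul_left_of_hasCompactSupport hφ hc

theorem continuous_fderiv_apply_of_contDiff {n : ℕ} {φ : Config n → ℝ} (hφ : ContDiff ℝ ∞ φ)
    (v : Config n) : Continuous fun X => fderiv ℝ φ X v :=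
  (hφ.continuous_fderiv (by simp)).clm_apply continuous_const

theorem integrable_fderiv_smul {n : ℕ} {f : Config n → ℂ} (hf : LocallyIntegrable f)
    {φ : Config n → ℝ} (hφ : ContDiff ℝ ∞ φ) (hc : HasCompactSupport φ) (v : Config n) :
    Integrable (fun X => fderiv ℝ φ X v • f X) :=
  integrable_test_smul hf (continuous_fderiv_apply_of_contDiff hφ v) (hc.fderiv_apply ℝ v)

theorem locallyIntegrable_of_memLp_two {n : ℕ} {f : Config n → ℂ} (hf : MemLp f 2 volume) :
    LocallyIntegrable f := hf.locallyIntegrable (by norm_num)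

/-- Made for the product rule `IsWeakDeriv.phase`, where both sides take this form with `r = i` and
with `p`, `q` equal to plus or minus the derivative of the exponent. -/
theorem integral_linear_comb {n : ℕ} {a b c d : Config n → ℂ} (ha : Integrable a)
    (hb : Integrable b) (hc : Integrable c) (hd : Integrable d) {p q r : ℂ} :
    ∫ X, (a X + p * b X + r * (c X + q * d X))
      = (∫ X, a X) + p * (∫ X, b X) + r * ((∫ X, c X) + q * ∫ X, d X) := by
  have h1 : Integrable fun X => a X + p * b X := ha.add (hb.const_mul p)
  have h2 : Integrable fun X => c X + q * d X := hc.add (hd.const_mul q)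
  rw [integral_add h1 (h2.const_mul r), integral_add ha (hb.const_mul p), integral_const_mul,
    integral_const_mul, integral_add hc (hd.const_mul q), integral_const_mul]

namespace IsWeakDeriv

variable {n : ℕ} {f g f' g' : Config n → ℂ} {v w : Config n}

theorem congr (h : IsWeakDeriv f g v) (hf : f =ᵐ[volume] f') (hg : g =ᵐ[volume] g') :
    IsWeakDeriv f' g' v := by
  intro φ hφ hc
  have h1 : (fun X => fderiv ℝ φ X v • f' X) =ᵐ[volume] fun X => fderiv ℝ φ X v • f X :=
    hf.mono fun X hX => by simp only [hX]
  have h2 : (fun X => φ X • g' X) =ᵐ[volume] fun X => φ X • g X :=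
    hg.mono fun X hX => by simp only [hX]
  rw [integral_congr_ae h1, integral_congr_ae h2, h φ hφ hc]

/-- Fundamental lemma of the calculus of variations: smooth compactly supported functions separate
locally integrable ones. -/
theorem unique (h : IsWeakDeriv f g v) (h' : IsWeakDeriv f g' v)
    (hg : LocallyIntegrable g) (hg' : LocallyIntegrable g') : g =ᵐ[volume] g' := by
  refine ae_eq_of_integral_contDiff_smul_eq hg hg' fun φ hφ hc => ?_
  have := (h φ hφ hc).symm.trans (h' φ hφ hc)
  exact neg_injective this

theorem add_direction (h : IsWeakDeriv f g v) (h' : IsWeakDeriv f g' w)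
    (hf : LocallyIntegrable f) (hg : LocallyIntegrable g) (hg' : LocallyIntegrable g') :
    IsWeakDeriv f (fun X => g X + g' X) (v + w) := by
  intro φ hφ hc
  simp only [map_add, add_smul, smul_add]
  rw [integral_add (integrable_fderiv_smul hf hφ hc v) (integrable_fderiv_smul hf hφ hc w),
    integral_add (integrable_test_smul hg hφ.continuous hc)
      (integrable_test_smul hg' hφ.continuous hc), h φ hφ hc, h' φ hφ hc]
  ring

theorem smul_direction (h : IsWeakDeriv f g v) (c : ℝ) :
    IsWeakDeriv f (fun X => (c : ℂ) * g X) (c • v) := by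
  intro φ hφ hc
  simp only [map_smul, smul_eq_mul, mul_smul]
  rw [integral_smul, h φ hφ hc, smul_neg, ← integral_smul]
  congr 2
  funext X
  simp only [Complex.real_smul]
  ring

theorem zero_direction : IsWeakDeriv f (fun _ => 0) 0 := by
  intro φ _ _
  simp

/-- Needed because a rotation sends a coordinate direction to a linear combination of the three
directions of the same particle. -/
theorem sum_direction {ι : Type*} (s : Finset ι) {g : ι → Config n → ℂ} {v : ι → Config n}
    (c : ι → ℝ) (hf : LocallyIntegrable f) (h : ∀ i ∈ s, IsWeakDeriv f (g i) (v i))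
    (hg : ∀ i ∈ s, MemLp (g i) 2 volume) :
    IsWeakDeriv f (fun X => ∑ i ∈ s, (c i : ℂ) * g i X) (∑ i ∈ s, c i • v i) := by
  classical
  induction s using Finset.induction_on with
  | empty => simpa using zero_direction
  | insert i s hi ih =>
    simp only [Finset.sum_insert hi]
    refine ((h i (by simp)).smul_direction (c i)).add_direction
      (ih (fun j hj => h j (by simp [hj])) fun j hj => hg j (by simp [hj])) hf ?_ ?_
    · exact locallyIntegrable_of_memLp_two ((hg i (by simp)).const_mul _)
    · exact locallyIntegrable_of_memLp_two
        (memLp_finsetSum s fun j hj => (hg j (by simp [hj])).const_mul _)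

/-- Weak derivatives of the pullback along a measure preserving affine bijection. -/
theorem comp_affine (L : Config n ≃L[ℝ] Config n) (b : Config n)
    (hL : MeasurePreserving (fun X => L X + b) volume volume) (h : IsWeakDeriv f g (L v)) :
    IsWeakDeriv (fun X => f (L X + b)) (fun X => g (L X + b)) v := by
  intro φ hφ hc
  let A : Config n ≃ₜ Config n := L.toHomeomorph.trans (Homeomorph.addRight b)
  have hA : ∀ X, A X = L X + b := fun X => rfl
  have hAs : ∀ Y, A.symm Y = L.symm (Y - b) := fun Y => by
    apply A.injective
    rw [Homeomorph.apply_symm_apply, hA]; simp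
  -- The test function is transported by the inverse motion, so that ψ at the image of X equals
  -- φ(X). By the chain rule its derivative along `L v` there is the derivative of φ along `v` at X.
  let ψ : Config n → ℝ := fun Y => φ (L.symm (Y - b))
  have hψ : ContDiff ℝ ∞ ψ :=
    hφ.comp (L.symm.contDiff.comp (contDiff_id.sub contDiff_const))
  have hψc : HasCompactSupport ψ := by
    have := hc.comp_homeomorph A.symm
    convert this using 1
    funext Y
    simp [ψ, hAs]
  have hψA : ∀ X, ψ (L X + b) = φ X := fun X => by simp [ψ]
  have hd : ∀ X, fderiv ℝ ψ (L X + b) (L v) = fderiv ℝ φ X v := by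
    intro X
    have h1 : HasFDerivAt (fun X => L X + b) (L : Config n →L[ℝ] Config n) X :=
      (L : Config n →L[ℝ] Config n).hasFDerivAt.add_const b
    have h2 := ((hψ.differentiable (by simp)) (L X + b)).hasFDerivAt.comp X h1
    have h3 : (ψ ∘ fun X => L X + b) = φ := funext hψA
    rw [h3] at h2
    rw [h2.fderiv]
    rfl
  have e1 := hL.integral_comp A.measurableEmbedding fun Y => fderiv ℝ ψ Y (L v) • f Y
  have e2 := hL.integral_comp A.measurableEmbedding fun Y => ψ Y • g Y
  simp only [hd, hψA] at e1 e2
  rw [e1, e2]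
  exact h ψ hψ hψc

theorem conj (h : IsWeakDeriv f g v) :
    IsWeakDeriv (fun X => starRingEnd ℂ (f X)) (fun X => starRingEnd ℂ (g X)) v := by
  intro φ hφ hc
  have h1 := congrArg (starRingEnd ℂ) (h φ hφ hc)
  rw [map_neg, ← integral_conj, ← integral_conj] at h1
  simpa only [Complex.real_smul, map_mul, Complex.conj_ofReal] using h1

/-- Product rule for a phase factor `exp(iℓ)`. -/
theorem phase (h : IsWeakDeriv f g v) (hf : LocallyIntegrable f) (hg : LocallyIntegrable g)
    (l : Config n →L[ℝ] ℝ) :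
    IsWeakDeriv (fun X => Complex.exp (l X * Complex.I) * f X)
      (fun X => Complex.exp (l X * Complex.I) * (g X + (l v * Complex.I) * f X)) v := by
  intro φ hφ hc
  have hcos : ContDiff ℝ ∞ fun X => Real.cos (l X) := Real.contDiff_cos.comp l.contDiff
  have hsin : ContDiff ℝ ∞ fun X => Real.sin (l X) := Real.contDiff_sin.comp l.contDiff
  have dφ : ∀ X, HasFDerivAt φ (fderiv ℝ φ X) X :=
    fun X => (hφ.differentiable (by simp) X).hasFDerivAt
  -- Test functions are real, so the phase cannot be absorbed into one of them; φ cos ℓ and φ sin ℓ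
  -- are tested separately and recombined as real part plus `i` times imaginary part.
  have hC := h (fun X => φ X * Real.cos (l X)) (hφ.mul hcos) hc.mul_right
  have hS := h (fun X => φ X * Real.sin (l X)) (hφ.mul hsin) hc.mul_right
  have dC : ∀ X, fderiv ℝ (fun X => φ X * Real.cos (l X)) X v
      = fderiv ℝ φ X v * Real.cos (l X) - l v * (φ X * Real.sin (l X)) := fun X => by
    have e : fderiv ℝ (fun X => φ X * Real.cos (l X)) X = _ :=
      ((dφ X).mul (l.hasFDerivAt (x := X)).cos).fderiv
    rw [e]
    simp; ring
  have dS : ∀ X, fderiv ℝ (fun X => φ X * Real.sin (l X)) X v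
      = fderiv ℝ φ X v * Real.sin (l X) + l v * (φ X * Real.cos (l X)) := fun X => by
    have e : fderiv ℝ (fun X => φ X * Real.sin (l X)) X = _ :=
      ((dφ X).mul (l.hasFDerivAt (x := X)).sin).fderiv
    rw [e]
    simp; ring
  have iC := integrable_test_smul hf (hφ.mul hcos).continuous hc.mul_right
  have iS := integrable_test_smul hf (hφ.mul hsin).continuous hc.mul_right
  have jC := integrable_test_smul hg (hφ.mul hcos).continuous hc.mul_right
  have jS := integrable_test_smul hg (hφ.mul hsin).continuous hc.mul_right
  have kC := integrable_fderiv_smul hf (hφ.mul hcos) hc.mul_right v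
  have kS := integrable_fderiv_smul hf (hφ.mul hsin) hc.mul_right v
  have hexp : ∀ X, Complex.exp (l X * Complex.I)
      = (Real.cos (l X) : ℂ) + (Real.sin (l X) : ℂ) * Complex.I := fun X => by
    rw [Complex.exp_mul_I, Complex.ofReal_cos, Complex.ofReal_sin]
  have lhs : ∫ X, fderiv ℝ φ X v • (Complex.exp (l X * Complex.I) * f X)
      = ((∫ X, fderiv ℝ (fun X => φ X * Real.cos (l X)) X v • f X)
        + (l v : ℂ) * ∫ X, (φ X * Real.sin (l X)) • f X)
        + Complex.I * ((∫ X, fderiv ℝ (fun X => φ X * Real.sin (l X)) X v • f X)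
        - (l v : ℂ) * ∫ X, (φ X * Real.cos (l X)) • f X) := by
    rw [sub_eq_add_neg, ← neg_mul, ← integral_linear_comb kC iS kS iC]
    congr 1
    funext X
    rw [dC, dS, hexp]
    simp only [Complex.real_smul]
    push_cast
    ring
  have rhs : ∫ X, φ X • (Complex.exp (l X * Complex.I) * (g X + (l v * Complex.I) * f X))
      = ((∫ X, (φ X * Real.cos (l X)) • g X)
        - (l v : ℂ) * ∫ X, (φ X * Real.sin (l X)) • f X)
        + Complex.I * ((∫ X, (φ X * Real.sin (l X)) • g X)
        + (l v : ℂ) * ∫ X, (φ X * Real.cos (l X)) • f X) := by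
    rw [sub_eq_add_neg, ← neg_mul, ← integral_linear_comb jC iS jS iC]
    congr 1
    funext X
    rw [hexp]
    simp only [Complex.real_smul, Complex.ofReal_mul, Complex.ofReal_sin, Complex.ofReal_cos]
    linear_combination ((φ X : ℂ) * Complex.sin (l X) * l v * f X) * Complex.I_sq
  rw [lhs, rhs, hC, hS]
  ring

end IsWeakDeriv

/-! ### Weak partial derivatives of fermionic wave functions -/

theorem memLp_wave {n : ℕ} (Ψ : Fermion n) : MemLp (wave Ψ) 2 volume := Lp.memLp _

theorem memLp_weakPartial {n : ℕ} (Ψ : Fermion n) (i : Fin n) (k : Fin 3) :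
    MemLp (weakPartial Ψ i k) 2 volume := by
  unfold weakPartial
  split_ifs with h
  · exact h.choose_spec.1
  · exact MemLp.zero

theorem isWeakPartial_weakPartial {n : ℕ} {Ψ : Fermion n} (h : MemH1 Ψ) (i : Fin n) (k : Fin 3) :
    IsWeakPartial (wave Ψ) (weakPartial Ψ i k) i k := by
  unfold weakPartial
  rw [dif_pos (h i k)]
  exact (h i k).choose_spec.2

/-- `weakPartial` is an arbitrary choice. By uniqueness any explicit square integrable weak
derivative may replace it, which is how derivatives of transformed orbitals are computed. -/
theorem weakPartial_ae_eq {n : ℕ} {Ψ : Fermion n} {i : Fin n} {k : Fin 3} {g : Config n → ℂ}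
    (hg : MemLp g 2 volume) (h : IsWeakPartial (wave Ψ) g i k) :
    weakPartial Ψ i k =ᵐ[volume] g := by
  have hex : ∃ g : Config n → ℂ, MemLp g 2 volume ∧ IsWeakPartial (wave Ψ) g i k := ⟨g, hg, h⟩
  have h' : IsWeakPartial (wave Ψ) (weakPartial Ψ i k) i k := by
    unfold weakPartial
    rw [dif_pos hex]
    exact hex.choose_spec.2
  exact IsWeakDeriv.unique h' h (locallyIntegrable_of_memLp_two (memLp_weakPartial Ψ i k))
    (locallyIntegrable_of_memLp_two hg)

/-- Antisymmetry moves a partial derivative from one particle to another. -/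
theorem weakPartial_perm {n : ℕ} {Ψ : Fermion n} (hΨ : MemH1 Ψ) (σ : Equiv.Perm (Fin n))
    (i : Fin n) (k : Fin 3) :
    weakPartial Ψ (σ i) k =ᵐ[volume]
      fun X => ((Equiv.Perm.sign σ : ℤ) : ℂ) * weakPartial Ψ i k (X ∘ σ) := by
  have hmp := measurePreserving_perm σ
  let L : Config n ≃L[ℝ] Config n :=
    (LinearEquiv.funCongrLeft ℝ E3 σ).toContinuousLinearEquiv
  have hL : ∀ X, L X = X ∘ σ := fun X => rfl
  have hu : L (unitVec (σ i) k) = unitVec i k := by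
    rw [hL]
    funext j
    simp only [unitVec, Function.comp]
    by_cases hj : j = i
    · subst hj; simp
    · rw [Pi.single_eq_of_ne hj, Pi.single_eq_of_ne (fun h => hj (σ.injective h))]
  have h0 : IsWeakDeriv (wave Ψ) (weakPartial Ψ i k) (L (unitVec (σ i) k)) := by
    rw [hu]; exact isWeakPartial_weakPartial hΨ i k
  have h1 := h0.comp_affine (g := weakPartial Ψ i k) L 0 (by simpa [hL] using hmp)
  simp only [add_zero, hL] at h1
  -- A sign is its own inverse, so the sign from antisymmetry of Ψ can be moved to the derivative.
  have hs : ((Equiv.Perm.sign σ : ℤ) : ℂ) * ((Equiv.Perm.sign σ : ℤ) : ℂ) = 1 := by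
    rcases Int.units_eq_one_or (Equiv.Perm.sign σ) with h | h <;> simp [h]
  refine weakPartial_ae_eq
    (((memLp_weakPartial Ψ i k).comp_measurePreserving hmp).const_mul _) ?_
  intro φ hφ hc
  have h2 := h1 φ hφ hc
  have h3 : ∫ X, (fderiv ℝ φ X (unitVec (σ i) k)) • wave Ψ (X ∘ σ)
      = ((Equiv.Perm.sign σ : ℤ) : ℂ) * ∫ X, (fderiv ℝ φ X (unitVec (σ i) k)) • wave Ψ X := by
    rw [← integral_const_mul]
    refine integral_congr_ae ((Ψ.2 σ).mono fun X hX => ?_)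
    simp only [wave, hX, Complex.real_smul]
    ring
  have h4 : ∫ X, φ X • (((Equiv.Perm.sign σ : ℤ) : ℂ) * weakPartial Ψ i k (X ∘ σ))
      = ((Equiv.Perm.sign σ : ℤ) : ℂ) * ∫ X, φ X • weakPartial Ψ i k (X ∘ σ) := by
    rw [← integral_const_mul]
    congr 1
    funext X
    simp only [Complex.real_smul]
    ring
  rw [h3] at h2
  rw [h4, ← mul_neg, ← h2, ← mul_assoc, hs, one_mul]

/-! ### Splitting off the first particle -/

theorem piFinSuccAbove_symm_eq_vecCons (n : ℕ) :
    (fun p : E3 × Config n => (Matrix.vecCons p.1 p.2 : Config (n + 1)))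
      = ⇑(MeasurableEquiv.piFinSuccAbove (fun _ : Fin (n + 1) => E3) 0).symm := by
  funext p
  simp [MeasurableEquiv.piFinSuccAbove, Matrix.vecCons, Fin.insertNthEquiv]

theorem measurePreserving_vecCons (n : ℕ) :
    MeasurePreserving (fun p : E3 × Config n => (Matrix.vecCons p.1 p.2 : Config (n + 1)))
      (volume.prod volume) volume := by
  rw [piFinSuccAbove_symm_eq_vecCons]
  exact (volume_preserving_piFinSuccAbove (fun _ : Fin (n + 1) => E3) 0).symm

theorem measurableEmbedding_vecCons (n : ℕ) :
    MeasurableEmbedding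
      (fun p : E3 × Config n => (Matrix.vecCons p.1 p.2 : Config (n + 1))) := by
  rw [piFinSuccAbove_symm_eq_vecCons]
  exact (MeasurableEquiv.piFinSuccAbove (fun _ : Fin (n + 1) => E3) 0).symm.measurableEmbedding

theorem ae_ae_vecCons {n : ℕ} {P : Config (n + 1) → Prop} (h : ∀ᵐ X, P X) :
    ∀ᵐ x : E3, ∀ᵐ Y : Config n, P (Matrix.vecCons x Y) :=
  Measure.ae_ae_of_ae_prod ((measurePreserving_vecCons n).quasiMeasurePreserving.ae h)

theorem aemeasurable_lintegral_vecCons {n : ℕ} {F : Config (n + 1) → ℝ≥0∞} (hF : AEMeasurable F) :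
    AEMeasurable fun x : E3 => ∫⁻ Y : Config n, F (Matrix.vecCons x Y) :=
  (hF.comp_quasiMeasurePreserving
    (measurePreserving_vecCons n).quasiMeasurePreserving).lintegral_prod_right'

theorem lintegral_vecCons {n : ℕ} {F : Config (n + 1) → ℝ≥0∞} (hF : AEMeasurable F) :
    ∫⁻ x : E3, ∫⁻ Y : Config n, F (Matrix.vecCons x Y) = ∫⁻ X, F X := by
  have h1 := (measurePreserving_vecCons n).lintegral_comp_emb (measurableEmbedding_vecCons n) F
  rw [← h1]
  exact (lintegral_prod _ (hF.comp_quasiMeasurePreserving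
    (measurePreserving_vecCons n).quasiMeasurePreserving)).symm

theorem aemeasurable_enorm_sq {n : ℕ} {f : Config n → ℂ} (hf : MemLp f 2 volume) :
    AEMeasurable fun X => ‖f X‖ₑ ^ 2 := hf.1.enorm.pow_const 2

theorem lintegral_enorm_sq_ne_top {α : Type*} [MeasurableSpace α] {μ : Measure α} {f : α → ℂ}
    (hf : MemLp f 2 μ) : ∫⁻ X, ‖f X‖ₑ ^ 2 ∂μ ≠ ⊤ := by
  have h := lintegral_rpow_enorm_lt_top_of_eLpNorm_lt_top (by norm_num) (by norm_num) hf.2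
  simp only [ENNReal.toReal_ofNat, ENNReal.rpow_ofNat] at h
  exact h.ne

theorem memLp_two_of_lintegral_ne_top {α : Type*} [MeasurableSpace α] {μ : Measure α} {f : α → ℂ}
    (hf : AEStronglyMeasurable f μ) (h : ∫⁻ X, ‖f X‖ₑ ^ 2 ∂μ ≠ ⊤) : MemLp f 2 μ := by
  refine ⟨hf, ?_⟩
  rw [eLpNorm_lt_top_iff_lintegral_rpow_enorm_lt_top (by norm_num) (by norm_num)]
  simpa only [ENNReal.toReal_ofNat, ENNReal.rpow_ofNat] using h.lt_top

/-- Tonelli: the squared norms of the slices have a finite integral over x, so almost all of them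
are finite. -/
theorem memLp_vecCons {n : ℕ} {f : Config (n + 1) → ℂ} (hf : MemLp f 2 volume) :
    ∀ᵐ x : E3, MemLp (fun Y : Config n => f (Matrix.vecCons x Y)) 2 volume := by
  have hm : AEStronglyMeasurable
      (fun p : E3 × Config n => f (Matrix.vecCons p.1 p.2)) (volume.prod volume) :=
    hf.1.comp_quasiMeasurePreserving (measurePreserving_vecCons n).quasiMeasurePreserving
  have h1 := hm.prodMk_left
  have h2 : ∀ᵐ x : E3, ∫⁻ Y : Config n, ‖f (Matrix.vecCons x Y)‖ₑ ^ 2 < ⊤ := by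
    refine ae_lt_top' (aemeasurable_lintegral_vecCons (aemeasurable_enorm_sq hf)) ?_
    rw [lintegral_vecCons (aemeasurable_enorm_sq hf)]
    exact lintegral_enorm_sq_ne_top hf
  filter_upwards [h1, h2] with x hx hx'
  exact memLp_two_of_lintegral_ne_top hx hx'.ne

/-! ### One-particle densities of an orbital -/

/-- The kinetic energy density of one particle in the state `Ψ`. -/
def orbitalKinetic {n : ℕ} (Ψ : Fermion (n + 1)) (x : E3) : ℝ≥0∞ :=
  ∑ k : Fin 3, ∫⁻ Y : Config n, ‖weakPartial Ψ 0 k (Matrix.vecCons x Y)‖ₑ ^ 2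

/-- The position density of one particle in the state `Ψ`. -/
def orbitalDensity {n : ℕ} (Ψ : Fermion (n + 1)) (x : E3) : ℝ≥0∞ :=
  ∫⁻ Y : Config n, ‖wave Ψ (Matrix.vecCons x Y)‖ₑ ^ 2

/-- The current density of one particle in the state `Ψ`. -/
def orbitalCurrent {n : ℕ} (Ψ : Fermion (n + 1)) (x : E3) : E3 :=
  WithLp.toLp 2 fun k : Fin 3 =>
    (∫ Y : Config n, weakPartial Ψ 0 k (Matrix.vecCons x Y) *
        starRingEnd ℂ (wave Ψ (Matrix.vecCons x Y))).im

theorem aemeasurable_orbitalKinetic {n : ℕ} (Ψ : Fermion (n + 1)) :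
    AEMeasurable (orbitalKinetic Ψ) :=
  Finset.aemeasurable_fun_sum _ fun k _ =>
    aemeasurable_lintegral_vecCons (aemeasurable_enorm_sq (memLp_weakPartial Ψ 0 k))

theorem aemeasurable_orbitalDensity {n : ℕ} (Ψ : Fermion (n + 1)) :
    AEMeasurable (orbitalDensity Ψ) :=
  aemeasurable_lintegral_vecCons (aemeasurable_enorm_sq (memLp_wave Ψ))

theorem lintegral_orbitalDensity {n : ℕ} (Ψ : Fermion (n + 1)) :
    ∫⁻ x, orbitalDensity Ψ x = ∫⁻ X, ‖wave Ψ X‖ₑ ^ 2 :=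
  lintegral_vecCons (aemeasurable_enorm_sq (memLp_wave Ψ))

/-- Exchanging particles 0 and i preserves the measure and changes the derivative only by a sign. -/
theorem lintegral_weakPartial_eq {n : ℕ} {Ψ : Fermion (n + 1)} (hΨ : MemH1 Ψ) (i : Fin (n + 1))
    (k : Fin 3) : ∫⁻ X, ‖weakPartial Ψ i k X‖ₑ ^ 2 = ∫⁻ X, ‖weakPartial Ψ 0 k X‖ₑ ^ 2 := by
  have h := weakPartial_perm hΨ (Equiv.swap 0 i) 0 k
  rw [Equiv.swap_apply_left] at h
  have hmp := measurePreserving_perm (Equiv.swap 0 i)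
  rw [lintegral_congr_ae (h.mono fun X hX => by rw [hX])]
  have hs : ∀ X : Config (n + 1),
      ‖((Equiv.Perm.sign (Equiv.swap 0 i) : ℤ) : ℂ) * weakPartial Ψ 0 k (X ∘ Equiv.swap 0 i)‖ₑ ^ 2
        = ‖weakPartial Ψ 0 k (X ∘ Equiv.swap 0 i)‖ₑ ^ 2 := by
    intro X
    rcases Int.units_eq_one_or (Equiv.Perm.sign (Equiv.swap 0 i)) with h | h <;> simp [h]
  simp_rw [hs]
  have hg : AEMeasurable (fun X => ‖weakPartial Ψ 0 k X‖ₑ ^ 2)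
      (Measure.map (fun X : Config (n + 1) => X ∘ Equiv.swap 0 i) volume) := by
    rw [hmp.map_eq]
    exact aemeasurable_enorm_sq (memLp_weakPartial Ψ 0 k)
  rw [← lintegral_map' hg hmp.measurable.aemeasurable, hmp.map_eq]

/-- All particles contribute equally, so the kinetic energy can be read off from the first particle,
the one through which density and current are defined. -/
theorem kineticForm_succ {n : ℕ} {Ψ : Fermion (n + 1)} (hΨ : MemH1 Ψ) :
    kineticForm Ψ = ((n + 1 : ℕ) : ℝ≥0∞) * ∫⁻ x, orbitalKinetic Ψ x := by
  unfold kineticForm orbitalKinetic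
  rw [lintegral_finsetSum' _ fun k _ =>
    aemeasurable_lintegral_vecCons (aemeasurable_enorm_sq (memLp_weakPartial Ψ 0 k))]
  simp_rw [lintegral_weakPartial_eq hΨ]
  rw [Finset.sum_const, Finset.card_univ, Fintype.card_fin, nsmul_eq_mul]
  congr 1
  exact Finset.sum_congr rfl fun k _ =>
    (lintegral_vecCons (aemeasurable_enorm_sq (memLp_weakPartial Ψ 0 k))).symm

theorem kineticForm_zero (Ψ : Fermion 0) : kineticForm Ψ = 0 := by
  simp [kineticForm]

theorem toReal_lintegral_enorm_sq {α : Type*} [MeasurableSpace α] {μ : Measure α} {f : α → ℂ}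
    (hf : MemLp f 2 μ) : (∫⁻ X, ‖f X‖ₑ ^ 2 ∂μ).toReal = ∫ X, ‖f X‖ ^ 2 ∂μ := by
  have hm : AEStronglyMeasurable (fun X => ‖f X‖ ^ 2) μ := hf.1.norm.pow 2
  rw [integral_eq_lintegral_of_nonneg_ae (Filter.Eventually.of_forall fun X => by positivity) hm]
  congr 1
  refine lintegral_congr fun X => ?_
  rw [ENNReal.ofReal_pow (norm_nonneg _), ofReal_norm]

theorem integrable_norm_sq {α : Type*} [MeasurableSpace α] {μ : Measure α} {f : α → ℂ}
    (hf : MemLp f 2 μ) : Integrable (fun X => ‖f X‖ ^ 2) μ := hf.integrable_norm_pow (by norm_num)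

theorem integrable_mul_conj {α : Type*} [MeasurableSpace α] {μ : Measure α} {f g : α → ℂ}
    (hf : MemLp f 2 μ) (hg : MemLp g 2 μ) :
    Integrable (fun X => f X * starRingEnd ℂ (g X)) μ := by
  have hg' : MemLp (fun X => starRingEnd ℂ (g X)) 2 μ := hg.star
  exact hf.integrable_mul hg'

/-- From |g w̄| ≤ |g|² + |w|². This bound dominates the series of orbital currents in
`FockState.hasSum_current`. -/
theorem abs_orbitalCurrent_le {n : ℕ} (Ψ : Fermion (n + 1)) :
    ∀ᵐ x, ∀ k, |orbitalCurrent Ψ x k| ≤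
      (orbitalKinetic Ψ x).toReal + (orbitalDensity Ψ x).toReal := by
  have h := fun k => memLp_vecCons (memLp_weakPartial Ψ 0 k)
  filter_upwards [ae_all_iff.2 h, memLp_vecCons (memLp_wave Ψ)] with x hg hw k
  have h1 : (orbitalKinetic Ψ x).toReal
      = ∑ k, ∫ Y : Config n, ‖weakPartial Ψ 0 k (Matrix.vecCons x Y)‖ ^ 2 := by
    rw [orbitalKinetic, ENNReal.toReal_sum fun k _ => lintegral_enorm_sq_ne_top (hg k)]
    exact Finset.sum_congr rfl fun k _ => toReal_lintegral_enorm_sq (hg k)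
  have h2 : (orbitalDensity Ψ x).toReal
      = ∫ Y : Config n, ‖wave Ψ (Matrix.vecCons x Y)‖ ^ 2 := toReal_lintegral_enorm_sq hw
  have h3 : ∫ Y : Config n, ‖weakPartial Ψ 0 k (Matrix.vecCons x Y)‖ ^ 2 ≤
      (orbitalKinetic Ψ x).toReal := by
    rw [h1]
    exact Finset.single_le_sum
      (f := fun k => ∫ Y : Config n, ‖weakPartial Ψ 0 k (Matrix.vecCons x Y)‖ ^ 2)
      (fun k _ => integral_nonneg fun Y => by positivity) (Finset.mem_univ k)
  calc |orbitalCurrent Ψ x k|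
      ≤ ‖∫ Y : Config n, weakPartial Ψ 0 k (Matrix.vecCons x Y) *
        starRingEnd ℂ (wave Ψ (Matrix.vecCons x Y))‖ := Complex.abs_im_le_norm _
    _ ≤ ∫ Y : Config n, ‖weakPartial Ψ 0 k (Matrix.vecCons x Y) *
        starRingEnd ℂ (wave Ψ (Matrix.vecCons x Y))‖ := norm_integral_le_integral_norm _
    _ ≤ ∫ Y : Config n, (‖weakPartial Ψ 0 k (Matrix.vecCons x Y)‖ ^ 2
        + ‖wave Ψ (Matrix.vecCons x Y)‖ ^ 2) := by
      refine integral_mono (integrable_mul_conj (hg k) hw).norm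
        ((integrable_norm_sq (hg k)).add (integrable_norm_sq hw)) fun Y => ?_
      simp only [norm_mul, RCLike.norm_conj]
      nlinarith [sq_nonneg (‖weakPartial Ψ 0 k (Matrix.vecCons x Y)‖
        - ‖wave Ψ (Matrix.vecCons x Y)‖), sq_nonneg (‖weakPartial Ψ 0 k (Matrix.vecCons x Y)‖
        + ‖wave Ψ (Matrix.vecCons x Y)‖)]
    _ ≤ _ := by
      rw [integral_add (integrable_norm_sq (hg k)) (integrable_norm_sq hw), h2]
      gcongr

/-! ### Densities of a state -/

namespace FockState

/-- The kinetic energy density of a state. -/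
def kineticDensity (Γ : FockState) (x : E3) : ℝ≥0∞ :=
  ∑' n : ℕ, ∑' j : ℕ, ENNReal.ofReal (Γ.weight (n + 1) j) * ((n + 1 : ℕ) : ℝ≥0∞) *
    orbitalKinetic (Γ.orbital (n + 1) j) x

theorem density_eq (Γ : FockState) (x : E3) : Γ.density x =
    ∑' n : ℕ, ∑' j : ℕ, ENNReal.ofReal (Γ.weight (n + 1) j) * ((n + 1 : ℕ) : ℝ≥0∞) *
      orbitalDensity (Γ.orbital (n + 1) j) x := rfl

theorem aemeasurable_kineticDensity (Γ : FockState) : AEMeasurable Γ.kineticDensity :=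
  AEMeasurable.tsum fun _ => AEMeasurable.tsum fun _ =>
    (aemeasurable_orbitalKinetic _).const_mul _

theorem aemeasurable_density (Γ : FockState) : AEMeasurable Γ.density :=
  AEMeasurable.tsum fun _ => AEMeasurable.tsum fun _ =>
    (aemeasurable_orbitalDensity _).const_mul _

theorem lintegral_kineticDensity (Γ : FockState) : ∫⁻ x, Γ.kineticDensity x = Γ.kinetic := by
  -- The kinetic energy is summed from the vacuum sector on, the density from one particle on; the
  -- vacuum term is split off and vanishes.
  have h0 := tsum_eq_zero_add' (f := fun n => ∑' j, ENNReal.ofReal (Γ.weight n j) *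
    kineticForm (Γ.orbital n j)) ENNReal.summable
  unfold kineticDensity kinetic
  rw [lintegral_tsum fun _ => AEMeasurable.tsum fun _ =>
    (aemeasurable_orbitalKinetic _).const_mul _, h0]
  simp only [kineticForm_zero, mul_zero, tsum_zero, zero_add]
  refine tsum_congr fun n => ?_
  rw [lintegral_tsum fun _ => (aemeasurable_orbitalKinetic _).const_mul _]
  refine tsum_congr fun j => ?_
  rw [lintegral_const_mul'' _ (aemeasurable_orbitalKinetic _), kineticForm_succ (Γ.memH1 _ _),
    mul_assoc]

theorem lintegral_density (Γ : FockState) : ∫⁻ x, Γ.density x =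
    ∑' n : ℕ, ∑' j : ℕ, ENNReal.ofReal (Γ.weight (n + 1) j) *
      (((n + 1 : ℕ) : ℝ≥0∞) * ∫⁻ X, ‖wave (Γ.orbital (n + 1) j) X‖ₑ ^ 2) := by
  simp_rw [density_eq]
  rw [lintegral_tsum fun _ => AEMeasurable.tsum fun _ =>
    (aemeasurable_orbitalDensity _).const_mul _]
  refine tsum_congr fun n => ?_
  rw [lintegral_tsum fun _ => (aemeasurable_orbitalDensity _).const_mul _]
  refine tsum_congr fun j => ?_
  rw [lintegral_const_mul'' _ (aemeasurable_orbitalDensity _), lintegral_orbitalDensity, mul_assoc]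

theorem kineticDensity_lt_top (Γ : FockState) : ∀ᵐ x, Γ.kineticDensity x < ⊤ :=
  ae_lt_top' Γ.aemeasurable_kineticDensity (by
    rw [lintegral_kineticDensity]; exact Γ.kinetic_ne_top)

theorem density_lt_top (Γ : FockState) (h : ∫⁻ x, Γ.density x ≠ ⊤) : ∀ᵐ x, Γ.density x < ⊤ :=
  ae_lt_top' Γ.aemeasurable_density h

end FockState

/-! ### Euclidean motions, constant boosts and time reversal -/

/-- A symmetry transformation of wave functions,
`Ψ ↦ exp(i ∑ⱼ ⟨boost, xⱼ⟩) conj (Ψ (rot x₁ + shift, …, rot xₙ + shift))`, where `conj` is the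
identity (`sign = 1`) or the complex conjugation (`sign = -1`). -/
structure WaveSymmetry where
  /-- the rotation -/
  rot : E3 ≃ₗᵢ[ℝ] E3
  /-- the translation -/
  shift : E3
  /-- the wave vector of the phase factor -/
  boost : E3
  /-- the identity or the complex conjugation -/
  conj : ℂ →+* ℂ
  /-- the effect of `conj` on imaginary parts -/
  sign : ℝ
  conj_eq : (conj = RingHom.id ℂ ∧ sign = 1) ∨ (conj = starRingEnd ℂ ∧ sign = -1)

namespace WaveSymmetry

variable (S : WaveSymmetry)

theorem conj_im (z : ℂ) : (S.conj z).im = S.sign * z.im := by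
  rcases S.conj_eq with ⟨h1, h2⟩ | ⟨h1, h2⟩ <;> simp [h1, h2]

theorem conj_re (z : ℂ) : (S.conj z).re = z.re := by
  rcases S.conj_eq with ⟨h1, h2⟩ | ⟨h1, h2⟩ <;> simp [h1]

theorem sign_mul_self : S.sign * S.sign = 1 := by
  rcases S.conj_eq with ⟨h1, h2⟩ | ⟨h1, h2⟩ <;> simp [h2]

theorem norm_conj (z : ℂ) : ‖S.conj z‖ = ‖z‖ := by
  rcases S.conj_eq with ⟨h1, h2⟩ | ⟨h1, h2⟩ <;> simp [h1]

theorem conj_star (z : ℂ) : S.conj (starRingEnd ℂ z) = starRingEnd ℂ (S.conj z) := by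
  rcases S.conj_eq with ⟨h1, h2⟩ | ⟨h1, h2⟩ <;> simp [h1]

theorem continuous_conj : Continuous S.conj := by
  rcases S.conj_eq with ⟨h1, h2⟩ | ⟨h1, h2⟩
  · rw [h1]; exact continuous_id
  · rw [h1]; exact Complex.continuous_conj

theorem integral_conj' {α : Type*} [MeasurableSpace α] {μ : Measure α} (f : α → ℂ) :
    ∫ X, S.conj (f X) ∂μ = S.conj (∫ X, f X ∂μ) := by
  rcases S.conj_eq with ⟨h1, h2⟩ | ⟨h1, h2⟩
  · simp [h1]
  · rw [h1]; exact integral_conj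

theorem isWeakDeriv_conj {n : ℕ} {f g : Config n → ℂ} {v : Config n} (h : IsWeakDeriv f g v) :
    IsWeakDeriv (fun X => S.conj (f X)) (fun X => S.conj (g X)) v := by
  rcases S.conj_eq with ⟨h1, h2⟩ | ⟨h1, h2⟩
  · simpa [h1] using h
  · rw [h1]; exact h.conj

/-- The motion of one particle. -/
def pos (x : E3) : E3 := S.rot x + S.shift

/-- The motion of all particles. -/
def config {n : ℕ} (X : Config n) : Config n := fun i => S.pos (X i)

theorem measurePreserving_pos : MeasurePreserving S.pos volume volume :=
  (measurePreserving_add_right volume S.shift).comp S.rot.measurePreserving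

theorem measurePreserving_config (n : ℕ) :
    MeasurePreserving (S.config : Config n → Config n) volume volume :=
  volume_preserving_pi (f := fun _ : Fin n => S.pos) fun _ => S.measurePreserving_pos

/-- The linear part of `config`. -/
def linearConfig (n : ℕ) : Config n ≃L[ℝ] Config n :=
  ContinuousLinearEquiv.piCongrRight fun _ => S.rot.toContinuousLinearEquiv

theorem measurableEmbedding_config (n : ℕ) :
    MeasurableEmbedding (S.config : Config n → Config n) :=
  ((S.linearConfig n).toHomeomorph.trans
    (Homeomorph.addRight (fun _ => S.shift))).measurableEmbedding

theorem measurableEmbedding_pos : MeasurableEmbedding S.pos :=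
  (S.rot.toContinuousLinearEquiv.toHomeomorph.trans
    (Homeomorph.addRight S.shift)).measurableEmbedding

theorem config_vecCons {n : ℕ} (x : E3) (Y : Config n) :
    S.config (Matrix.vecCons x Y : Config (n + 1)) = Matrix.vecCons (S.pos x) (S.config Y) := by
  funext i
  refine Fin.cases ?_ (fun j => ?_) i <;> simp [config]

theorem config_perm {n : ℕ} (X : Config n) (π : Equiv.Perm (Fin n)) :
    S.config (X ∘ π) = S.config X ∘ π := rfl

theorem linearConfig_unitVec {n : ℕ} (i : Fin n) (k : Fin 3) :
    S.linearConfig n (unitVec i k)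
      = ∑ l, S.rot (EuclideanSpace.single k 1) l • unitVec i l := by
  funext j
  have h0 : S.linearConfig n (unitVec i k) j = S.rot (unitVec i k j) := rfl
  rw [h0, Finset.sum_apply]
  by_cases hj : j = i
  · subst hj
    ext m
    simp [unitVec, Fin.sum_univ_three]
    fin_cases m <;> simp
  · simp [unitVec, Pi.single_eq_of_ne hj]

/-- The exponent `∑ⱼ ⟨boost, xⱼ⟩` of the phase factor. -/
def exponent (n : ℕ) : Config n →L[ℝ] ℝ :=
  ∑ i : Fin n, (innerSL ℝ S.boost).comp (ContinuousLinearMap.proj i)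

/-- Every particle receives the same boost, so the phase is symmetric and multiplication by it keeps
antisymmetry. -/
theorem exponent_perm {n : ℕ} (X : Config n) (π : Equiv.Perm (Fin n)) :
    S.exponent n (X ∘ π) = S.exponent n X := by
  simp only [exponent, sum_apply, ContinuousLinearMap.comp_apply,
    ContinuousLinearMap.proj_apply, Function.comp]
  exact Equiv.sum_comp π fun i => innerSL ℝ S.boost (X i)

theorem exponent_unitVec {n : ℕ} (i : Fin n) (k : Fin 3) :
    S.exponent n (unitVec i k) = S.boost k := by
  simp only [exponent, sum_apply, ContinuousLinearMap.comp_apply,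
    ContinuousLinearMap.proj_apply, unitVec]
  rw [Finset.sum_eq_single i]
  · simp [EuclideanSpace.inner_single_right]
  · intro j _ hj
    rw [Pi.single_eq_of_ne hj, map_zero]
  · simp

/-- The phase factor. -/
def phase {n : ℕ} (X : Config n) : ℂ := Complex.exp (S.exponent n X * Complex.I)

theorem norm_phase {n : ℕ} (X : Config n) : ‖S.phase X‖ = 1 := Complex.norm_exp_ofReal_mul_I _

theorem phase_mul_conj {n : ℕ} (X : Config n) : S.phase X * starRingEnd ℂ (S.phase X) = 1 := by
  rw [Complex.mul_conj, Complex.normSq_eq_norm_sq, norm_phase]; simp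

theorem continuous_phase (n : ℕ) : Continuous (S.phase : Config n → ℂ) := by
  unfold phase; fun_prop

/-- The transformation of functions. -/
def mapFun {n : ℕ} (f : Config n → ℂ) (X : Config n) : ℂ := S.phase X * S.conj (f (S.config X))

theorem norm_mapFun {n : ℕ} (f : Config n → ℂ) (X : Config n) :
    ‖S.mapFun f X‖ = ‖f (S.config X)‖ := by
  rw [mapFun, norm_mul, norm_phase, one_mul, norm_conj]

theorem memLp_mapFun {n : ℕ} {f : Config n → ℂ} (hf : MemLp f 2 volume) :
    MemLp (S.mapFun f) 2 volume := by
  have h := hf.comp_measurePreserving (S.measurePreserving_config n)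
  refine h.congr_norm ((S.continuous_phase n).aestronglyMeasurable.mul
    (S.continuous_conj.comp_aestronglyMeasurable h.1)) ?_
  exact Filter.Eventually.of_forall fun X => (S.norm_mapFun f X).symm

/-- The transformation of fermionic wave functions. -/
def map {n : ℕ} (Ψ : Fermion n) : Fermion n :=
  ⟨(S.memLp_mapFun (memLp_wave Ψ)).toLp, by
    intro π
    have h0 := (S.memLp_mapFun (memLp_wave Ψ)).coeFn_toLp
    filter_upwards [h0, (measurePreserving_perm π).quasiMeasurePreserving.ae h0,
      (S.measurePreserving_config n).quasiMeasurePreserving.ae (Ψ.2 π)] with X h1 h2 h3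
    rw [h1, h2, mapFun, mapFun, config_perm, wave, h3, map_mul, map_intCast, phase, exponent_perm]
    rw [phase]
    ring⟩

theorem wave_map {n : ℕ} (Ψ : Fermion n) : wave (S.map Ψ) =ᵐ[volume] S.mapFun (wave Ψ) :=
  (S.memLp_mapFun (memLp_wave Ψ)).coeFn_toLp

/-- The phases cancel pointwise and the motion preserves the measure, so the map is unitary or
antiunitary. Either way orthonormality survives, since 0 and 1 are real. -/
theorem inner_map {n : ℕ} (Ψ Φ : Fermion n) :
    inner ℂ (S.map Ψ) (S.map Φ) = S.conj (inner ℂ Ψ Φ) := by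
  rw [Submodule.coe_inner, Submodule.coe_inner, L2.inner_def, L2.inner_def, ← S.integral_conj']
  refine Eq.trans (integral_congr_ae ?_)
    ((S.measurePreserving_config n).integral_comp (S.measurableEmbedding_config n)
      fun X => S.conj (inner ℂ (wave Ψ X) (wave Φ X)))
  filter_upwards [S.wave_map Ψ, S.wave_map Φ] with X h1 h2
  change inner ℂ (wave (S.map Ψ) X) (wave (S.map Φ) X)
    = S.conj (inner ℂ (wave Ψ (S.config X)) (wave Φ (S.config X)))
  rw [h1, h2]
  simp only [RCLike.inner_apply, mapFun, map_mul, conj_star]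
  linear_combination (S.conj (wave Φ (S.config X)) * starRingEnd ℂ (S.conj (wave Ψ (S.config X))))
    * S.phase_mul_conj X

/-- The weak derivatives of `S.mapFun f` in terms of `f` and its weak derivatives `g`. -/
def mapPartial {n : ℕ} (f : Config n → ℂ) (g : Fin 3 → Config n → ℂ) (k : Fin 3)
    (X : Config n) : ℂ :=
  S.phase X * ((∑ l, (S.rot (EuclideanSpace.single k 1) l : ℂ) * S.conj (g l (S.config X)))
    + (S.boost k * Complex.I) * S.conj (f (S.config X)))

theorem memLp_mapPartial {n : ℕ} {f : Config n → ℂ} {g : Fin 3 → Config n → ℂ}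
    (hf : MemLp f 2 volume) (hg : ∀ l, MemLp (g l) 2 volume) (k : Fin 3) :
    MemLp (S.mapPartial f g k) 2 volume := by
  have h : MemLp (fun X => (∑ l, (S.rot (EuclideanSpace.single k 1) l : ℂ) * S.mapFun (g l) X)
      + (S.boost k * Complex.I) * S.mapFun f X) 2 volume :=
    (memLp_finsetSum _ fun l _ => (S.memLp_mapFun (hg l)).const_mul _).add
      ((S.memLp_mapFun hf).const_mul _)
  convert h using 1
  funext X
  simp only [mapPartial, mapFun, Fin.sum_univ_three]
  ring

theorem conj_ofReal (r : ℝ) : S.conj r = r := by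
  rcases S.conj_eq with ⟨h1, h2⟩ | ⟨h1, h2⟩ <;> simp [h1]

/-- Composes the calculus rules: linear combination of directions, affine change of variables,
conjugation, phase factor. -/
theorem isWeakPartial_mapFun {n : ℕ} {f : Config n → ℂ} {g : Fin 3 → Config n → ℂ} {i : Fin n}
    (hf : MemLp f 2 volume) (hg : ∀ l, MemLp (g l) 2 volume)
    (h : ∀ l, IsWeakPartial f (g l) i l) (k : Fin 3) :
    IsWeakPartial (S.mapFun f) (S.mapPartial f g k) i k := by
  have h1 := IsWeakDeriv.sum_direction Finset.univ (g := g) (v := unitVec i)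
    (fun l => S.rot (EuclideanSpace.single k 1) l)
    (locallyIntegrable_of_memLp_two hf) (fun l _ => h l) (fun l _ => hg l)
  rw [← linearConfig_unitVec] at h1
  have h2 := h1.comp_affine (S.linearConfig n) (fun _ => S.shift) (S.measurePreserving_config n)
  have hmem : MemLp (fun X => ∑ l, (S.rot (EuclideanSpace.single k 1) l : ℂ) * g l X) 2 volume :=
    memLp_finsetSum _ fun l _ => (hg l).const_mul _
  have hconj : ∀ F : Config n → ℂ, MemLp F 2 volume →
      LocallyIntegrable fun X => S.conj (F (S.config X)) := fun F hF => by
    have hF' := hF.comp_measurePreserving (S.measurePreserving_config n)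
    refine locallyIntegrable_of_memLp_two (hF'.congr_norm
      (S.continuous_conj.comp_aestronglyMeasurable hF'.1) ?_)
    exact Filter.Eventually.of_forall fun X => (S.norm_conj _).symm
  have h3 := (S.isWeakDeriv_conj h2).phase (hconj f hf) (hconj _ hmem) (S.exponent n)
  rw [exponent_unitVec] at h3
  refine h3.congr (Filter.Eventually.of_forall fun X => rfl)
    (Filter.Eventually.of_forall fun X => ?_)
  simp only [map_sum, map_mul, conj_ofReal]
  rfl

theorem isWeakPartial_map {n : ℕ} {Ψ : Fermion n} (hΨ : MemH1 Ψ) (i : Fin n) (k : Fin 3) :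
    IsWeakPartial (wave (S.map Ψ)) (S.mapPartial (wave Ψ) (weakPartial Ψ i) k) i k :=
  IsWeakDeriv.congr (S.isWeakPartial_mapFun (memLp_wave Ψ) (memLp_weakPartial Ψ i)
    (isWeakPartial_weakPartial hΨ i) k) (S.wave_map Ψ).symm (Filter.EventuallyEq.refl _ _)

theorem memH1_map {n : ℕ} {Ψ : Fermion n} (hΨ : MemH1 Ψ) : MemH1 (S.map Ψ) := fun i k =>
  ⟨_, S.memLp_mapPartial (memLp_wave Ψ) (memLp_weakPartial Ψ i) k, S.isWeakPartial_map hΨ i k⟩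

theorem weakPartial_map {n : ℕ} {Ψ : Fermion n} (hΨ : MemH1 Ψ) (i : Fin n) (k : Fin 3) :
    weakPartial (S.map Ψ) i k =ᵐ[volume] S.mapPartial (wave Ψ) (weakPartial Ψ i) k :=
  weakPartial_ae_eq (S.memLp_mapPartial (memLp_wave Ψ) (memLp_weakPartial Ψ i) k)
    (S.isWeakPartial_map hΨ i k)

/-- An isometry is orthogonal: its inverse is its transpose. -/
theorem rot_symm_apply (x : E3) (k : Fin 3) :
    S.rot.symm x k = ∑ l, S.rot (EuclideanSpace.single k 1) l * x l := by
  have h : inner ℝ (EuclideanSpace.single k (1 : ℝ)) (S.rot.symm x)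
      = inner ℝ (S.rot (EuclideanSpace.single k (1 : ℝ))) x := by
    rw [← S.rot.inner_map_map, LinearIsometryEquiv.apply_symm_apply]
  rw [EuclideanSpace.inner_single_left] at h
  simp only [map_one, one_mul] at h
  rw [h, PiLp.inner_apply]
  refine Finset.sum_congr rfl fun l _ => ?_
  simp [mul_comm]

theorem sum_rot_sq (x : Fin 3 → ℝ) :
    ∑ k, (∑ l, S.rot (EuclideanSpace.single k 1) l * x l) ^ 2 = ∑ l, x l ^ 2 := by
  have h : ‖S.rot.symm (WithLp.toLp 2 x)‖ ^ 2 = ‖(WithLp.toLp 2 x : E3)‖ ^ 2 := by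
    rw [LinearIsometryEquiv.norm_map]
  rw [EuclideanSpace.real_norm_sq_eq, EuclideanSpace.real_norm_sq_eq] at h
  simpa only [rot_symm_apply] using h

/-- The phases cancel, `conj` commutes with the real rotation coefficients and multiplies imaginary
parts by `sign`, and the boost contributes i κₖ |f|². -/
theorem mapPartial_mul_conj_im {n : ℕ} (f : Config n → ℂ) (g : Fin 3 → Config n → ℂ) (k : Fin 3)
    (X : Config n) :
    (S.mapPartial f g k X * starRingEnd ℂ (S.mapFun f X)).im =
      S.sign * (∑ l, S.rot (EuclideanSpace.single k 1) l *
        (g l (S.config X) * starRingEnd ℂ (f (S.config X))).im)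
      + S.boost k * ‖f (S.config X)‖ ^ 2 := by
  have h : S.mapPartial f g k X * starRingEnd ℂ (S.mapFun f X) =
      S.conj (∑ l, (S.rot (EuclideanSpace.single k 1) l : ℂ) *
        (g l (S.config X) * starRingEnd ℂ (f (S.config X))))
      + (S.boost k * Complex.I) *
        (S.conj (f (S.config X)) * starRingEnd ℂ (S.conj (f (S.config X)))) := by
    simp only [mapPartial, mapFun, map_mul, map_add, conj_ofReal, conj_star, Fin.sum_univ_three]
    linear_combination (((S.rot (EuclideanSpace.single k 1) 0 : ℂ) * S.conj (g 0 (S.config X))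
      + (S.rot (EuclideanSpace.single k 1) 1 : ℂ) * S.conj (g 1 (S.config X))
      + (S.rot (EuclideanSpace.single k 1) 2 : ℂ) * S.conj (g 2 (S.config X))
      + (S.boost k * Complex.I) * S.conj (f (S.config X))) *
      starRingEnd ℂ (S.conj (f (S.config X)))) * S.phase_mul_conj X
  rw [h, Complex.add_im, conj_im, Complex.im_sum, Complex.mul_conj, Complex.normSq_eq_norm_sq,
    norm_conj]
  congr 1
  · simp only [Complex.im_ofReal_mul]
  · rw [mul_right_comm, ← Complex.ofReal_mul, Complex.im_ofReal_mul,
      Complex.I_im, mul_one]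

/-- Expansion of |Rᵀz + iκw|², where z and w are the gradient and the value after `conj`: Rᵀ
preserves the norm of the real and imaginary parts of z, and the cross term is twice the pairing of
κ with the transformed current. -/
theorem sum_norm_mapPartial_sq {n : ℕ} (f : Config n → ℂ) (g : Fin 3 → Config n → ℂ)
    (X : Config n) :
    ∑ k, ‖S.mapPartial f g k X‖ ^ 2 = ∑ l, ‖g l (S.config X)‖ ^ 2
      + 2 * (∑ k, S.boost k * (S.sign * ∑ l, S.rot (EuclideanSpace.single k 1) l *
        (g l (S.config X) * starRingEnd ℂ (f (S.config X))).im))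
      + ‖S.boost‖ ^ 2 * ‖f (S.config X)‖ ^ 2 := by
  set w := f (S.config X)
  set z := fun l => g l (S.config X)
  have hz : ∀ l, g l (S.config X) = z l := fun l => rfl
  have h1 := S.sum_rot_sq fun l => (S.conj (z l)).re
  have h2 := S.sum_rot_sq fun l => (S.conj (z l)).im
  have h3 : ∀ c : ℂ, ‖c‖ ^ 2 = c.re ^ 2 + c.im ^ 2 := fun c => by
    rw [← Complex.normSq_eq_norm_sq, Complex.normSq_apply]; ring
  have hs := S.sign_mul_self
  simp only [conj_re, conj_im] at h1 h2
  rw [EuclideanSpace.real_norm_sq_eq]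
  simp only [mapPartial, norm_mul, norm_phase, one_mul, hz]
  simp only [h3, Fin.sum_univ_three, Complex.add_re, Complex.add_im, Complex.mul_re,
    Complex.mul_im, Complex.I_re, Complex.I_im, Complex.ofReal_re, Complex.ofReal_im, conj_re,
    conj_im, Complex.conj_re, Complex.conj_im] at h1 h2 ⊢
  linear_combination h1 + h2 + ((z 0).im ^ 2 + (z 1).im ^ 2 + (z 2).im ^ 2
    + w.im ^ 2 * (S.boost 0 ^ 2 + S.boost 1 ^ 2 + S.boost 2 ^ 2)) * hs

end WaveSymmetry

theorem orbitalCurrent_eq_integral {n : ℕ} (Ψ : Fermion (n + 1)) :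
    ∀ᵐ x, ∀ k, orbitalCurrent Ψ x k = ∫ Y : Config n, (weakPartial Ψ 0 k (Matrix.vecCons x Y) *
        starRingEnd ℂ (wave Ψ (Matrix.vecCons x Y))).im := by
  filter_upwards [ae_all_iff.2 fun k => memLp_vecCons (memLp_weakPartial Ψ 0 k),
    memLp_vecCons (memLp_wave Ψ)] with x hg hw k
  exact (integral_im (integrable_mul_conj (hg k) hw)).symm

theorem toReal_orbitalKinetic {n : ℕ} (Ψ : Fermion (n + 1)) :
    ∀ᵐ x, (orbitalKinetic Ψ x).toReal
      = ∫ Y : Config n, ∑ k, ‖weakPartial Ψ 0 k (Matrix.vecCons x Y)‖ ^ 2 := by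
  filter_upwards [ae_all_iff.2 fun k => memLp_vecCons (memLp_weakPartial Ψ 0 k)] with x hg
  rw [orbitalKinetic, ENNReal.toReal_sum fun k _ => lintegral_enorm_sq_ne_top (hg k),
    integral_finsetSum _ fun k _ => integrable_norm_sq (hg k)]
  exact Finset.sum_congr rfl fun k _ => toReal_lintegral_enorm_sq (hg k)

theorem toReal_orbitalDensity {n : ℕ} (Ψ : Fermion (n + 1)) :
    ∀ᵐ x, (orbitalDensity Ψ x).toReal
      = ∫ Y : Config n, ‖wave Ψ (Matrix.vecCons x Y)‖ ^ 2 := by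
  filter_upwards [memLp_vecCons (memLp_wave Ψ)] with x hw
  exact toReal_lintegral_enorm_sq hw

namespace WaveSymmetry

variable (S : WaveSymmetry)

/-! ### Transformation of the one-particle densities -/

theorem lintegral_config {n : ℕ} (F : Config n → ℝ≥0∞) :
    ∫⁻ X, F (S.config X) = ∫⁻ X, F X :=
  (S.measurePreserving_config n).lintegral_comp_emb (S.measurableEmbedding_config n) F

theorem integral_config {n : ℕ} {E : Type*} [NormedAddCommGroup E] [NormedSpace ℝ E]
    (F : Config n → E) : ∫ X, F (S.config X) = ∫ X, F X :=
  (S.measurePreserving_config n).integral_comp (S.measurableEmbedding_config n) F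

theorem ae_pos {P : E3 → Prop} (h : ∀ᵐ x, P x) : ∀ᵐ x, P (S.pos x) :=
  S.measurePreserving_pos.quasiMeasurePreserving.ae h

theorem orbitalDensity_map {n : ℕ} (Ψ : Fermion (n + 1)) :
    ∀ᵐ x, orbitalDensity (S.map Ψ) x = orbitalDensity Ψ (S.pos x) := by
  filter_upwards [ae_ae_vecCons (S.wave_map Ψ)] with x hx
  unfold orbitalDensity
  rw [← S.lintegral_config fun Y => ‖wave Ψ (Matrix.vecCons (S.pos x) Y)‖ₑ ^ 2]
  refine lintegral_congr_ae (hx.mono fun Y hY => ?_)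
  simp only
  rw [hY, ← config_vecCons, ← enorm_norm, norm_mapFun, enorm_norm]

/-- `mapPartial_mul_conj_im` integrated over the other particles, whose own motion disappears by a
change of variables. -/
theorem orbitalCurrent_map {n : ℕ} {Ψ : Fermion (n + 1)} (hΨ : MemH1 Ψ) :
    ∀ᵐ x, orbitalCurrent (S.map Ψ) x = S.sign • S.rot.symm (orbitalCurrent Ψ (S.pos x))
      + (orbitalDensity Ψ (S.pos x)).toReal • S.boost := by
  filter_upwards [ae_ae_vecCons (S.wave_map Ψ),
    ae_all_iff.2 fun k => ae_ae_vecCons (S.weakPartial_map hΨ 0 k),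
    S.ae_pos (ae_all_iff.2 fun k => memLp_vecCons (memLp_weakPartial Ψ 0 k)),
    S.ae_pos (memLp_vecCons (memLp_wave Ψ)), orbitalCurrent_eq_integral (S.map Ψ),
    S.ae_pos (orbitalCurrent_eq_integral Ψ), S.ae_pos (toReal_orbitalDensity Ψ)]
    with x h1 h2 hg hw hc hc' hd
  ext k
  have hint : ∀ l, Integrable fun Y : Config n =>
      (weakPartial Ψ 0 l (Matrix.vecCons (S.pos x) Y) *
        starRingEnd ℂ (wave Ψ (Matrix.vecCons (S.pos x) Y))).im :=
    fun l => (integrable_mul_conj (hg l) hw).im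
  have key : (fun Y : Config n => (weakPartial (S.map Ψ) 0 k (Matrix.vecCons x Y) *
        starRingEnd ℂ (wave (S.map Ψ) (Matrix.vecCons x Y))).im) =ᵐ[volume]
      fun Y => S.sign * (∑ l, S.rot (EuclideanSpace.single k 1) l *
        (weakPartial Ψ 0 l (Matrix.vecCons (S.pos x) (S.config Y)) *
          starRingEnd ℂ (wave Ψ (Matrix.vecCons (S.pos x) (S.config Y)))).im)
        + S.boost k * ‖wave Ψ (Matrix.vecCons (S.pos x) (S.config Y))‖ ^ 2 := by
    filter_upwards [h1, h2 k] with Y e1 e2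
    rw [e1, e2, mapPartial_mul_conj_im, config_vecCons]
  rw [hc k, integral_congr_ae key, S.integral_config fun Y =>
      S.sign * (∑ l, S.rot (EuclideanSpace.single k 1) l *
        (weakPartial Ψ 0 l (Matrix.vecCons (S.pos x) Y) *
          starRingEnd ℂ (wave Ψ (Matrix.vecCons (S.pos x) Y))).im)
        + S.boost k * ‖wave Ψ (Matrix.vecCons (S.pos x) Y)‖ ^ 2,
    integral_add ((integrable_finsetSum _ fun l _ => (hint l).const_mul _).const_mul _)
      ((integrable_norm_sq hw).const_mul _), integral_const_mul, integral_const_mul,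
    integral_finsetSum _ fun l _ => (hint l).const_mul _]
  simp only [integral_const_mul, ← hc', ← hd]
  rw [PiLp.add_apply, PiLp.smul_apply, PiLp.smul_apply, rot_symm_apply, smul_eq_mul, smul_eq_mul,
    mul_comm (S.boost k)]

/-- Stated for real numbers because the cross term has no sign. -/
theorem toReal_orbitalKinetic_map {n : ℕ} {Ψ : Fermion (n + 1)} (hΨ : MemH1 Ψ) :
    ∀ᵐ x, (orbitalKinetic (S.map Ψ) x).toReal = (orbitalKinetic Ψ (S.pos x)).toReal
      + 2 * inner ℝ S.boost (S.sign • S.rot.symm (orbitalCurrent Ψ (S.pos x)))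
      + ‖S.boost‖ ^ 2 * (orbitalDensity Ψ (S.pos x)).toReal := by
  filter_upwards [ae_ae_vecCons (S.wave_map Ψ),
    ae_all_iff.2 fun k => ae_ae_vecCons (S.weakPartial_map hΨ 0 k),
    S.ae_pos (ae_all_iff.2 fun k => memLp_vecCons (memLp_weakPartial Ψ 0 k)),
    S.ae_pos (memLp_vecCons (memLp_wave Ψ)), toReal_orbitalKinetic (S.map Ψ),
    S.ae_pos (orbitalCurrent_eq_integral Ψ), S.ae_pos (toReal_orbitalDensity Ψ),
    S.ae_pos (toReal_orbitalKinetic Ψ)]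
    with x h1 h2 hg hw hk hc' hd hk'
  have hint : ∀ l, Integrable fun Y : Config n =>
      (weakPartial Ψ 0 l (Matrix.vecCons (S.pos x) Y) *
        starRingEnd ℂ (wave Ψ (Matrix.vecCons (S.pos x) Y))).im :=
    fun l => (integrable_mul_conj (hg l) hw).im
  have key : (fun Y : Config n => ∑ k, ‖weakPartial (S.map Ψ) 0 k (Matrix.vecCons x Y)‖ ^ 2)
      =ᵐ[volume] fun Y =>
      ∑ l, ‖weakPartial Ψ 0 l (Matrix.vecCons (S.pos x) (S.config Y))‖ ^ 2
      + 2 * (∑ k, S.boost k * (S.sign * ∑ l, S.rot (EuclideanSpace.single k 1) l *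
        (weakPartial Ψ 0 l (Matrix.vecCons (S.pos x) (S.config Y)) *
          starRingEnd ℂ (wave Ψ (Matrix.vecCons (S.pos x) (S.config Y)))).im))
      + ‖S.boost‖ ^ 2 * ‖wave Ψ (Matrix.vecCons (S.pos x) (S.config Y))‖ ^ 2 := by
    filter_upwards [ae_all_iff.2 h2] with Y e2
    simp only [e2]
    rw [sum_norm_mapPartial_sq, config_vecCons]
  have i1 : Integrable fun Y : Config n =>
      ∑ l, ‖weakPartial Ψ 0 l (Matrix.vecCons (S.pos x) Y)‖ ^ 2 :=
    integrable_finsetSum _ fun l _ => integrable_norm_sq (hg l)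
  have i2 : ∀ k, Integrable fun Y : Config n => S.boost k * (S.sign *
      ∑ l, S.rot (EuclideanSpace.single k 1) l *
        (weakPartial Ψ 0 l (Matrix.vecCons (S.pos x) Y) *
          starRingEnd ℂ (wave Ψ (Matrix.vecCons (S.pos x) Y))).im) := fun k =>
    ((integrable_finsetSum _ fun l _ => (hint l).const_mul _).const_mul _).const_mul _
  have i3 : Integrable fun Y : Config n => 2 * ∑ k, S.boost k * (S.sign *
      ∑ l, S.rot (EuclideanSpace.single k 1) l *
        (weakPartial Ψ 0 l (Matrix.vecCons (S.pos x) Y) *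
          starRingEnd ℂ (wave Ψ (Matrix.vecCons (S.pos x) Y))).im) :=
    (integrable_finsetSum _ fun k _ => i2 k).const_mul _
  have i4 : Integrable fun Y : Config n =>
      ∑ l, ‖weakPartial Ψ 0 l (Matrix.vecCons (S.pos x) Y)‖ ^ 2
      + 2 * ∑ k, S.boost k * (S.sign * ∑ l, S.rot (EuclideanSpace.single k 1) l *
        (weakPartial Ψ 0 l (Matrix.vecCons (S.pos x) Y) *
          starRingEnd ℂ (wave Ψ (Matrix.vecCons (S.pos x) Y))).im) := i1.add i3
  rw [hk, integral_congr_ae key, S.integral_config fun Y =>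
      ∑ l, ‖weakPartial Ψ 0 l (Matrix.vecCons (S.pos x) Y)‖ ^ 2
      + 2 * (∑ k, S.boost k * (S.sign * ∑ l, S.rot (EuclideanSpace.single k 1) l *
        (weakPartial Ψ 0 l (Matrix.vecCons (S.pos x) Y) *
          starRingEnd ℂ (wave Ψ (Matrix.vecCons (S.pos x) Y))).im))
      + ‖S.boost‖ ^ 2 * ‖wave Ψ (Matrix.vecCons (S.pos x) Y)‖ ^ 2,
    integral_add i4 ((integrable_norm_sq hw).const_mul _), integral_add i1 i3,
    integral_const_mul, integral_const_mul, integral_finsetSum _ fun k _ => i2 k, ← hk', ← hd]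
  congr 3
  rw [PiLp.inner_apply]
  refine Finset.sum_congr rfl fun k _ => ?_
  rw [integral_const_mul, integral_const_mul,
    integral_finsetSum _ fun l _ => (hint l).const_mul _]
  simp only [integral_const_mul, ← hc', PiLp.smul_apply, rot_symm_apply]
  simp [mul_comm]

/-- Moduli ignore the phase and the conjugation, and the motion preserves distances between
particles. -/
theorem coulombForm_map {n : ℕ} (Ψ : Fermion n) : coulombForm (S.map Ψ) = coulombForm Ψ := by
  unfold coulombForm
  refine Finset.sum_congr rfl fun a _ => Finset.sum_congr rfl fun b _ => ?_
  rw [← S.lintegral_config fun X => ‖wave Ψ X‖ₑ ^ 2 / edist (X a) (X b)]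
  refine lintegral_congr_ae ((S.wave_map Ψ).mono fun X hX => ?_)
  simp only
  rw [hX, ← enorm_norm, norm_mapFun, enorm_norm]
  congr 1
  simp [config, pos]

/-- Parallelogram argument: the expansions for κ and -κ have opposite cross terms, and the sum
belonging to -κ is nonnegative and can be dropped. -/
theorem sum_norm_mapPartial_sq_le {n : ℕ} (f : Config n → ℂ) (g : Fin 3 → Config n → ℂ)
    (X : Config n) :
    ∑ k, ‖S.mapPartial f g k X‖ ^ 2 ≤ 2 * (∑ l, ‖g l (S.config X)‖ ^ 2)
      + 2 * ‖S.boost‖ ^ 2 * ‖f (S.config X)‖ ^ 2 := by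
  have h1 := S.sum_norm_mapPartial_sq f g X
  let S' : WaveSymmetry := { S with boost := -S.boost }
  have h2 := S'.sum_norm_mapPartial_sq f g X
  have h3 : 0 ≤ ∑ k, ‖S'.mapPartial f g k X‖ ^ 2 := Finset.sum_nonneg fun k _ => by positivity
  have hc : S'.config X = S.config X := rfl
  simp only [hc, S', norm_neg, PiLp.neg_apply, neg_mul, Finset.sum_neg_distrib] at h2 h3
  linarith

/-- A crude bound used only for finiteness: the transformed family must be known to be an admissible
state before the exact change of its kinetic energy is computed. -/
theorem kineticForm_map_le {n : ℕ} {Ψ : Fermion n} (hΨ : MemH1 Ψ) :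
    kineticForm (S.map Ψ) ≤ 2 * kineticForm Ψ
      + 2 * ‖S.boost‖ₑ ^ 2 * (n * ∫⁻ X, ‖wave Ψ X‖ₑ ^ 2) := by
  have hm : ∀ i k, AEMeasurable fun X => ‖weakPartial Ψ i k X‖ₑ ^ 2 :=
    fun i k => aemeasurable_enorm_sq (memLp_weakPartial Ψ i k)
  have hi : ∀ i : Fin n, ∑ k : Fin 3, ∫⁻ X, ‖weakPartial (S.map Ψ) i k X‖ₑ ^ 2 ≤
      2 * (∑ k : Fin 3, ∫⁻ X, ‖weakPartial Ψ i k X‖ₑ ^ 2)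
        + 2 * ‖S.boost‖ₑ ^ 2 * (∫⁻ X, ‖wave Ψ X‖ₑ ^ 2) := by
    intro i
    rw [← lintegral_finsetSum' _ fun k _ =>
        aemeasurable_enorm_sq (memLp_weakPartial (S.map Ψ) i k),
      ← lintegral_finsetSum' _ fun k _ => hm i k, ← lintegral_const_mul' _ _ (by simp),
      ← lintegral_const_mul' _ _ (by finiteness), ← lintegral_add_left'
        ((Finset.aemeasurable_fun_sum _ fun k _ => hm i k).const_mul _), ← S.lintegral_config fun X =>
        2 * (∑ k, ‖weakPartial Ψ i k X‖ₑ ^ 2) + 2 * ‖S.boost‖ₑ ^ 2 * ‖wave Ψ X‖ₑ ^ 2]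
    refine lintegral_mono_ae ?_
    filter_upwards [ae_all_iff.2 fun k => S.weakPartial_map hΨ i k] with X hX
    simp only [hX]
    have h := ENNReal.ofReal_le_ofReal (S.sum_norm_mapPartial_sq_le (wave Ψ) (weakPartial Ψ i) X)
    have e : ∀ {E : Type} [NormedAddCommGroup E] (c : E), ENNReal.ofReal (‖c‖ ^ 2) = ‖c‖ₑ ^ 2 :=
      fun c => by rw [ENNReal.ofReal_pow (norm_nonneg _), ofReal_norm]
    rw [ENNReal.ofReal_add (by positivity) (by positivity), ENNReal.ofReal_mul (by positivity),
      ENNReal.ofReal_mul (by positivity), ENNReal.ofReal_mul (by positivity),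
      ENNReal.ofReal_sum_of_nonneg fun _ _ => by positivity,
      ENNReal.ofReal_sum_of_nonneg fun _ _ => by positivity] at h
    simpa only [e, ENNReal.ofReal_ofNat] using h
  refine (Finset.sum_le_sum fun i _ => hi i).trans_eq ?_
  rw [Finset.sum_add_distrib, ← Finset.mul_sum, Finset.sum_const, Finset.card_univ,
    Fintype.card_fin, nsmul_eq_mul]
  unfold kineticForm
  ring

end WaveSymmetry

/-! ### Operators with prescribed eigenfunctions -/

/-- Antisymmetry under each permutation equates two continuous maps on L². The resulting
completeness lets series of rank-one operators converge. -/
theorem isClosed_fermion (n : ℕ) :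
    IsClosed (Fermion n : Set (Lp ℂ 2 (volume : Measure (Config n)))) := by
  have h : (Fermion n : Set (Lp ℂ 2 (volume : Measure (Config n)))) =
      ⋂ σ : Equiv.Perm (Fin n), {Ψ | Lp.compMeasurePreservingₗᵢ ℂ _ (measurePreserving_perm σ) Ψ
        = ((Equiv.Perm.sign σ : ℤ) : ℂ) • Ψ} := by
    ext Ψ
    simp only [Set.mem_iInter, Set.mem_ofPred_eq]
    refine forall_congr' fun σ => ?_
    have h1 := Lp.coeFn_compMeasurePreserving Ψ (measurePreserving_perm σ)
    have h2 := Lp.coeFn_smul ((Equiv.Perm.sign σ : ℤ) : ℂ) Ψ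
    change _ ↔ Lp.compMeasurePreserving _ (measurePreserving_perm σ) Ψ = _
    rw [Lp.ext_iff]
    constructor
    · intro h
      filter_upwards [h, h1, h2] with X a b c
      rw [b, c]
      exact a
    · intro h
      filter_upwards [h, h1, h2] with X a b c
      rw [b, c] at a
      exact a
  rw [h]
  exact isClosed_iInter fun σ => isClosed_eq (LinearIsometry.continuous _) (continuous_const_smul _)

instance completeSpace_fermion (n : ℕ) : CompleteSpace (Fermion n) :=
  (isClosed_fermion n).completeSpace_coe

/-- The rank-one terms have operator norm at most `w j`, so the series converges absolutely. Vectors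
of weight zero are unrestricted, as in `FockState.orthonormal`. -/
theorem exists_operator_of_eigenfunctions {H : Type*} [NormedAddCommGroup H]
    [InnerProductSpace ℂ H] [CompleteSpace H] {w : ℕ → ℝ} (hw : ∀ j, 0 ≤ w j) (hs : Summable w)
    {ψ : ℕ → H} (hψ : ∀ j, w j ≠ 0 → ‖ψ j‖ ≤ 1) :
    ∃ B : H →L[ℂ] H, ∀ Φ, HasSum (fun j => ((w j : ℂ) * inner ℂ (ψ j) Φ) • ψ j) (B Φ) := by
  let t : ℕ → H →L[ℂ] H := fun j => (w j : ℂ) • (innerSL ℂ (ψ j)).smulRight (ψ j)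
  have ht : ∀ j, ‖t j‖ ≤ w j := by
    intro j
    by_cases hj : w j = 0
    · simp [t, hj]
    · have h1 := hψ j hj
      simp only [t, norm_smul, ContinuousLinearMap.norm_smulRight_apply, innerSL_apply_norm,
        Complex.norm_real, Real.norm_of_nonneg (hw j)]
      calc w j * (‖ψ j‖ * ‖ψ j‖) ≤ w j * (1 * 1) := by
            gcongr
            exact hw j
        _ = w j := by ring
  have hsum : Summable t := Summable.of_norm_bounded hs ht
  refine ⟨∑' j, t j, fun Φ => ?_⟩
  have h := (ContinuousLinearMap.apply ℂ H Φ).hasSum hsum.hasSum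
  have e : (fun j => ((w j : ℂ) * inner ℂ (ψ j) Φ) • ψ j)
      = fun j => ContinuousLinearMap.apply ℂ H Φ (t j) := by
    funext j
    simp [t, mul_smul]
  rw [e]
  exact h

/-! ### Transformation of states -/

theorem hasSum_of_forall_eq {β E : Type*} [AddCommMonoid E] [TopologicalSpace E] {f g : β → E}
    {b : E} (h : HasSum f b) (hg : ∀ i, g i = f i) : HasSum g b := by
  rwa [funext hg]

namespace FockState

theorem summable_weight (Γ : FockState) (n : ℕ) : Summable (Γ.weight n) :=
  Γ.trace_eq_one.summable.prod_factor n

theorem orthonormal_map (Γ : FockState) (S : WaveSymmetry) (n : ℕ) :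
    Orthonormal ℂ (fun j : {j : ℕ // Γ.weight n j ≠ 0} => S.map (Γ.orbital n j)) := by
  classical
  rw [orthonormal_iff_ite]
  intro i j
  rw [S.inner_map, orthonormal_iff_ite.1 (Γ.orthonormal n) i j]
  split_ifs <;> simp

/-- A boost costs at most a multiple of |κ|² per particle, so a finite mean particle number is what
keeps the kinetic energy finite. -/
theorem kinetic_map_ne_top (Γ : FockState) (S : WaveSymmetry) (hΓ : ∫⁻ x, Γ.density x ≠ ⊤) :
    ∑' n, ∑' j, ENNReal.ofReal (Γ.weight n j) * kineticForm (S.map (Γ.orbital n j)) ≠ ⊤ := by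
  have hN : ∑' n : ℕ, ∑' j, ENNReal.ofReal (Γ.weight n j) *
      (n * ∫⁻ X, ‖wave (Γ.orbital n j) X‖ₑ ^ 2) = ∫⁻ x, Γ.density x := by
    have h0 := tsum_eq_zero_add' (f := fun n : ℕ => ∑' j, ENNReal.ofReal (Γ.weight n j) *
      (n * ∫⁻ X, ‖wave (Γ.orbital n j) X‖ₑ ^ 2)) ENNReal.summable
    rw [h0, lintegral_density]
    simp
  have hle : ∑' n, ∑' j, ENNReal.ofReal (Γ.weight n j) * kineticForm (S.map (Γ.orbital n j))
      ≤ 2 * Γ.kinetic + 2 * ‖S.boost‖ₑ ^ 2 * ∫⁻ x, Γ.density x := by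
    rw [← hN, kinetic, ← ENNReal.tsum_mul_left, ← ENNReal.tsum_mul_left, ← ENNReal.tsum_add]
    refine ENNReal.tsum_le_tsum fun n => ?_
    rw [← ENNReal.tsum_mul_left, ← ENNReal.tsum_mul_left, ← ENNReal.tsum_add]
    refine ENNReal.tsum_le_tsum fun j => ?_
    refine (mul_le_mul_right (S.kineticForm_map_le (Γ.memH1 n j)) _).trans_eq ?_
    ring
  refine ne_top_of_le_ne_top ?_ hle
  have hK : Γ.kinetic ≠ ⊤ := Γ.kinetic_ne_top
  finiteness

theorem exists_block_map (Γ : FockState) (S : WaveSymmetry) (n : ℕ) :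
    ∃ B : Fermion n →L[ℂ] Fermion n, ∀ Φ, HasSum (fun j => ((Γ.weight n j : ℂ) *
      inner ℂ (S.map (Γ.orbital n j)) Φ) • S.map (Γ.orbital n j)) (B Φ) :=
  exists_operator_of_eigenfunctions (Γ.weight_nonneg n) (Γ.summable_weight n)
    fun j hj => ((Γ.orthonormal_map S n).1 ⟨j, hj⟩).le

/-- The transformation of states of finite particle number. -/
def map (Γ : FockState) (S : WaveSymmetry) (hΓ : ∫⁻ x, Γ.density x ≠ ⊤) : FockState where
  block n := (Γ.exists_block_map S n).choose
  weight := Γ.weight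
  orbital n j := S.map (Γ.orbital n j)
  weight_nonneg := Γ.weight_nonneg
  orthonormal := Γ.orthonormal_map S
  spectral n := (Γ.exists_block_map S n).choose_spec
  trace_eq_one := Γ.trace_eq_one
  memH1 n j := S.memH1_map (Γ.memH1 n j)
  kinetic_ne_top := Γ.kinetic_map_ne_top S hΓ

theorem coulomb_map (Γ : FockState) (S : WaveSymmetry) (hΓ : ∫⁻ x, Γ.density x ≠ ⊤) :
    (Γ.map S hΓ).coulomb = Γ.coulomb := by
  simp only [coulomb, map, S.coulombForm_map]

theorem density_map (Γ : FockState) (S : WaveSymmetry) (hΓ : ∫⁻ x, Γ.density x ≠ ⊤) :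
    ∀ᵐ x, (Γ.map S hΓ).density x = Γ.density (S.pos x) := by
  filter_upwards [ae_all_iff.2 fun n => ae_all_iff.2 fun j =>
    S.orbitalDensity_map (Γ.orbital (n + 1) j)] with x hx
  rw [density_eq, density_eq]
  exact tsum_congr fun n => tsum_congr fun j => by rw [← hx]; rfl

/-- The weight of an orbital times its particle number. -/
def particleWeight (Γ : FockState) (p : ℕ × ℕ) : ℝ :=
  Γ.weight (p.1 + 1) p.2 * ((p.1 + 1 : ℕ) : ℝ)

theorem particleWeight_nonneg (Γ : FockState) (p : ℕ × ℕ) : 0 ≤ Γ.particleWeight p :=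
  mul_nonneg (Γ.weight_nonneg _ _) (Nat.cast_nonneg _)

/-- Turns an iterated sum in `ℝ≥0∞` into an unconditional real sum over pairs, to which linear maps
and signed combinations can be applied. -/
theorem hasSum_toReal (Γ : FockState) {F : ℕ → ℕ → ℝ≥0∞}
    (h : ∑' n : ℕ, ∑' j : ℕ, ENNReal.ofReal (Γ.weight (n + 1) j) * ((n + 1 : ℕ) : ℝ≥0∞) * F n j
      < ⊤) :
    HasSum (fun p : ℕ × ℕ => Γ.particleWeight p * (F p.1 p.2).toReal)
      (∑' n : ℕ, ∑' j : ℕ,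
        ENNReal.ofReal (Γ.weight (n + 1) j) * ((n + 1 : ℕ) : ℝ≥0∞) * F n j).toReal := by
  rw [← ENNReal.tsum_prod (f := fun n j => ENNReal.ofReal (Γ.weight (n + 1) j) *
    ((n + 1 : ℕ) : ℝ≥0∞) * F n j)] at h ⊢
  have h1 := ENNReal.hasSum_toReal h.ne
  rw [ENNReal.tsum_toReal_eq fun p => ENNReal.ne_top_of_tsum_ne_top h.ne p]
  convert h1 using 1
  · funext p
    rw [ENNReal.toReal_mul, ENNReal.toReal_mul, ENNReal.toReal_ofReal (Γ.weight_nonneg _ _),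
      ENNReal.toReal_natCast, particleWeight]

theorem hasSum_kineticDensity (Γ : FockState) : ∀ᵐ x,
    HasSum (fun p : ℕ × ℕ => Γ.particleWeight p *
      (orbitalKinetic (Γ.orbital (p.1 + 1) p.2) x).toReal) (Γ.kineticDensity x).toReal := by
  filter_upwards [Γ.kineticDensity_lt_top] with x hx
  exact Γ.hasSum_toReal (F := fun n j => orbitalKinetic (Γ.orbital (n + 1) j) x) hx

theorem hasSum_density (Γ : FockState) (hΓ : ∫⁻ x, Γ.density x ≠ ⊤) : ∀ᵐ x,
    HasSum (fun p : ℕ × ℕ => Γ.particleWeight p *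
      (orbitalDensity (Γ.orbital (p.1 + 1) p.2) x).toReal) (Γ.density x).toReal := by
  filter_upwards [Γ.density_lt_top hΓ] with x hx
  exact Γ.hasSum_toReal (F := fun n j => orbitalDensity (Γ.orbital (n + 1) j) x) hx

/-- `current` is an iterated real `tsum`, which would take a default value without summability. The
kinetic and particle densities are finite almost everywhere and dominate the series, so it converges
absolutely there. -/
theorem hasSum_current (Γ : FockState) (hΓ : ∫⁻ x, Γ.density x ≠ ⊤) : ∀ᵐ x,
    HasSum (fun p : ℕ × ℕ => Γ.particleWeight p • orbitalCurrent (Γ.orbital (p.1 + 1) p.2) x)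
      (Γ.current x) := by
  filter_upwards [Γ.hasSum_kineticDensity, Γ.hasSum_density hΓ, ae_all_iff.2 fun p : ℕ × ℕ =>
    abs_orbitalCurrent_le (Γ.orbital (p.1 + 1) p.2)] with x hk hd hc
  have hs : ∀ k, Summable fun p : ℕ × ℕ =>
      Γ.particleWeight p * orbitalCurrent (Γ.orbital (p.1 + 1) p.2) x k := fun k => by
    refine Summable.of_norm_bounded (hk.add hd).summable fun p => ?_
    rw [norm_mul, Real.norm_of_nonneg (Γ.particleWeight_nonneg p), ← mul_add]
    exact mul_le_mul_of_nonneg_left (hc p k) (Γ.particleWeight_nonneg p)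
  have h : HasSum (fun (p : ℕ × ℕ) (k : Fin 3) =>
      Γ.particleWeight p * orbitalCurrent (Γ.orbital (p.1 + 1) p.2) x k)
      (fun k => Γ.current x k) := by
    refine Pi.hasSum.2 fun k => ?_
    have e : Γ.current x k = ∑' p : ℕ × ℕ,
        Γ.particleWeight p * orbitalCurrent (Γ.orbital (p.1 + 1) p.2) x k := by
      rw [(hs k).tsum_prod]; rfl
    rw [e]
    exact (hs k).hasSum
  exact (PiLp.continuousLinearEquiv 2 ℝ fun _ : Fin 3 => ℝ).symm.hasSum.2 h

theorem lintegral_density_map (Γ : FockState) (S : WaveSymmetry) (hΓ : ∫⁻ x, Γ.density x ≠ ⊤) :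
    ∫⁻ x, (Γ.map S hΓ).density x = ∫⁻ x, Γ.density x := by
  rw [lintegral_congr_ae (Γ.density_map S hΓ)]
  exact S.measurePreserving_pos.lintegral_comp_emb S.measurableEmbedding_pos Γ.density

theorem current_map (Γ : FockState) (S : WaveSymmetry) (hΓ : ∫⁻ x, Γ.density x ≠ ⊤) :
    ∀ᵐ x, (Γ.map S hΓ).current x = S.sign • S.rot.symm (Γ.current (S.pos x))
      + (Γ.density (S.pos x)).toReal • S.boost := by
  filter_upwards [(Γ.map S hΓ).hasSum_current (by rwa [lintegral_density_map]),
    S.ae_pos (Γ.hasSum_current hΓ), S.ae_pos (Γ.hasSum_density hΓ), ae_all_iff.2 fun p : ℕ × ℕ =>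
    S.orbitalCurrent_map (Γ.memH1 (p.1 + 1) p.2)] with x h1 h2 h3 h4
  have h5 := (S.rot.symm.toContinuousLinearEquiv.toContinuousLinearMap.hasSum h2).const_smul S.sign
  refine h1.unique ?_
  have h6 := h5.add (h3.smul_const S.boost)
  refine hasSum_of_forall_eq h6 fun p => ?_
  change Γ.particleWeight p • orbitalCurrent (S.map (Γ.orbital (p.1 + 1) p.2)) x = _
  rw [h4 p, smul_add, smul_smul _ _ S.boost, smul_comm (Γ.particleWeight p) S.sign]
  congr 2
  exact (map_smul S.rot.symm _ _).symm

theorem toReal_kineticDensity_map (Γ : FockState) (S : WaveSymmetry)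
    (hΓ : ∫⁻ x, Γ.density x ≠ ⊤) :
    ∀ᵐ x, ((Γ.map S hΓ).kineticDensity x).toReal = (Γ.kineticDensity (S.pos x)).toReal
      + 2 * inner ℝ S.boost (S.sign • S.rot.symm (Γ.current (S.pos x)))
      + ‖S.boost‖ ^ 2 * (Γ.density (S.pos x)).toReal := by
  filter_upwards [(Γ.map S hΓ).hasSum_kineticDensity, S.ae_pos Γ.hasSum_kineticDensity,
    S.ae_pos (Γ.hasSum_current hΓ), S.ae_pos (Γ.hasSum_density hΓ), ae_all_iff.2 fun p : ℕ × ℕ =>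
    S.toReal_orbitalKinetic_map (Γ.memH1 (p.1 + 1) p.2)] with x h1 h0 h2 h3 h4
  have h5 := ((innerSL ℝ S.boost).hasSum
    ((S.rot.symm.toContinuousLinearEquiv.toContinuousLinearMap.hasSum h2).const_smul
      S.sign)).mul_left 2
  refine h1.unique ?_
  have h6 := (h0.add h5).add (h3.mul_left (‖S.boost‖ ^ 2))
  refine hasSum_of_forall_eq h6 fun p => ?_
  change Γ.particleWeight p * (orbitalKinetic (S.map (Γ.orbital (p.1 + 1) p.2)) x).toReal = _
  rw [h4 p]
  simp [inner_smul_right]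
  ring

theorem toReal_kinetic_eq (Γ : FockState) :
    Integrable (fun x => (Γ.kineticDensity x).toReal) ∧
      Γ.kinetic.toReal = ∫ x, (Γ.kineticDensity x).toReal := by
  have h : ∫⁻ x, Γ.kineticDensity x ≠ ⊤ := by
    rw [lintegral_kineticDensity]; exact Γ.kinetic_ne_top
  refine ⟨integrable_toReal_of_lintegral_ne_top Γ.aemeasurable_kineticDensity h, ?_⟩
  rw [integral_toReal Γ.aemeasurable_kineticDensity Γ.kineticDensity_lt_top,
    lintegral_kineticDensity]

/-- The change of the kinetic energy: only the boost contributes. -/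
theorem toReal_kinetic_map (Γ : FockState) (S : WaveSymmetry) (hΓ : ∫⁻ x, Γ.density x ≠ ⊤)
    (hj : Integrable Γ.current) :
    (Γ.map S hΓ).kinetic.toReal = Γ.kinetic.toReal
      + (2 * inner ℝ S.boost (S.sign • S.rot.symm (∫ x, Γ.current x))
      + ‖S.boost‖ ^ 2 * (∫⁻ x, Γ.density x).toReal) := by
  have i1 := Γ.toReal_kinetic_eq.1
  have i3 := integrable_toReal_of_lintegral_ne_top Γ.aemeasurable_density hΓ
  -- The cross term as a continuous linear functional of the current, so that it commutes with the
  -- integral.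
  let L : E3 →L[ℝ] ℝ := (2 * S.sign) • (innerSL ℝ S.boost).comp
    S.rot.symm.toContinuousLinearEquiv.toContinuousLinearMap
  have hL : ∀ v, L v = 2 * inner ℝ S.boost (S.sign • S.rot.symm v) := fun v => by
    simp [L, inner_smul_right]; ring
  have i2 : Integrable fun x => L (Γ.current x) := L.integrable_comp hj
  rw [(Γ.map S hΓ).toReal_kinetic_eq.2, integral_congr_ae (Γ.toReal_kineticDensity_map S hΓ)]
  simp only [← hL]
  have i12 : Integrable fun x => (Γ.kineticDensity x).toReal + L (Γ.current x) := i1.add i2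
  rw [S.measurePreserving_pos.integral_comp S.measurableEmbedding_pos
    (fun x => (Γ.kineticDensity x).toReal + L (Γ.current x) +
      ‖S.boost‖ ^ 2 * (Γ.density x).toReal), integral_add i12 (i3.const_mul _),
    integral_add i1 i2, integral_const_mul, L.integral_comp_comm hj, ← Γ.toReal_kinetic_eq.2,
    integral_toReal Γ.aemeasurable_density (Γ.density_lt_top hΓ), add_assoc]

/-- The effect of a symmetry transformation on the states of given densities. -/
theorem Represents.map {Γ : FockState} {ρ : E3 → ℝ} {j : E3 → E3} (h : Γ.Represents ρ j)
    (hρ : ∀ x, 0 ≤ ρ x) (S : WaveSymmetry) (hΓ : ∫⁻ x, Γ.density x ≠ ⊤) :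
    (Γ.map S hΓ).Represents (fun x => ρ (S.pos x))
      (fun x => S.sign • S.rot.symm (j (S.pos x)) + ρ (S.pos x) • S.boost) := by
  constructor
  · filter_upwards [Γ.density_map S hΓ, S.ae_pos h.1] with x h1 h2
    rw [h1, h2]
  · filter_upwards [Γ.current_map S hΓ, S.ae_pos h.1, S.ae_pos h.2] with x h1 h2 h3
    rw [h1, h2, h3, ENNReal.toReal_ofReal (hρ _)]

end FockState

/-! ### Constrained infima under a symmetry and its inverse -/

/-- The shift c may be negative while energies lie in `ℝ≥0∞`; its positive and negative parts are
therefore kept on opposite sides. -/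
theorem coe_ennreal_le_add_of_add_le {x y : ℝ≥0∞} {c : ℝ}
    (h : x + ENNReal.ofReal (-c) ≤ y + ENNReal.ofReal c) : (x : EReal) ≤ (y : EReal) + (c : EReal) := by
  have h' := EReal.coe_ennreal_le_coe_ennreal_iff.2 h
  rw [EReal.coe_ennreal_add, EReal.coe_ennreal_add] at h'
  rcases le_total 0 c with hc | hc
  · rwa [ENNReal.ofReal_of_nonpos (by linarith : -c ≤ 0), EReal.coe_ennreal_zero, add_zero,
      EReal.coe_ennreal_ofReal, max_eq_left hc] at h'
  · rw [ENNReal.ofReal_of_nonpos hc, EReal.coe_ennreal_zero, add_zero,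
      EReal.coe_ennreal_ofReal, max_eq_left (by linarith : 0 ≤ -c)] at h'
    have h2 := add_le_add_left h' (c : EReal)
    rwa [add_assoc, ← EReal.coe_add, neg_add_cancel, EReal.coe_zero, add_zero] at h2

namespace WaveSymmetry

variable (S : WaveSymmetry)

/-- The inverse transformation. -/
def symm : WaveSymmetry where
  rot := S.rot.symm
  shift := -S.rot.symm S.shift
  boost := -(S.sign • S.rot S.boost)
  conj := S.conj
  sign := S.sign
  conj_eq := S.conj_eq

theorem pos_symm_pos (x : E3) : S.pos (S.symm.pos x) = x := by
  simp [pos, symm]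

/-- The transformation of densities. -/
def mapDensity (ρ : E3 → ℝ) (x : E3) : ℝ := ρ (S.pos x)

/-- The transformation of current densities. -/
def mapCurrent (ρ : E3 → ℝ) (j : E3 → E3) (x : E3) : E3 :=
  S.sign • S.rot.symm (j (S.pos x)) + ρ (S.pos x) • S.boost

/-- The change of the kinetic energy of states with density `ρ` and current density `j`. -/
def kineticShift (ρ : E3 → ℝ) (j : E3 → E3) : ℝ :=
  2 * inner ℝ S.boost (S.sign • S.rot.symm (∫ x, j x)) + ‖S.boost‖ ^ 2 * ∫ x, ρ x

theorem symm_mapDensity (ρ : E3 → ℝ) : S.symm.mapDensity (S.mapDensity ρ) = ρ := by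
  funext x
  simp only [mapDensity, pos_symm_pos]

/-- The boost of `symm` is chosen so that the two multiples of ρ cancel; the two signs multiply to
1. -/
theorem symm_mapCurrent (ρ : E3 → ℝ) (j : E3 → E3) :
    S.symm.mapCurrent (S.mapDensity ρ) (S.mapCurrent ρ j) = j := by
  funext x
  simp only [mapCurrent, mapDensity, pos_symm_pos]
  simp [symm, smul_smul, S.sign_mul_self, smul_comm (ρ x) S.sign]

variable {ρ : E3 → ℝ} {j : E3 → E3}

theorem integrable_comp_pos {E : Type*} [NormedAddCommGroup E] {f : E3 → E} (hf : Integrable f) :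
    Integrable fun x => f (S.pos x) :=
  S.measurePreserving_pos.integrable_comp_of_integrable hf

theorem integral_comp_pos {E : Type*} [NormedAddCommGroup E] [NormedSpace ℝ E] (f : E3 → E) :
    ∫ x, f (S.pos x) = ∫ x, f x :=
  S.measurePreserving_pos.integral_comp S.measurableEmbedding_pos f

theorem lintegral_comp_pos (f : E3 → ℝ≥0∞) : ∫⁻ x, f (S.pos x) = ∫⁻ x, f x :=
  S.measurePreserving_pos.lintegral_comp_emb S.measurableEmbedding_pos f

theorem integrable_rot_symm (hj : Integrable j) :
    Integrable fun x => S.sign • S.rot.symm (j (S.pos x)) :=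
  (S.rot.symm.toContinuousLinearEquiv.toContinuousLinearMap.integrable_comp
    (S.integrable_comp_pos hj)).smul S.sign

theorem integrable_mapCurrent (hρ : Integrable ρ) (hj : Integrable j) :
    Integrable (S.mapCurrent ρ j) :=
  (S.integrable_rot_symm hj).add ((S.integrable_comp_pos hρ).smul_const _)

theorem integral_mapCurrent (hρ : Integrable ρ) (hj : Integrable j) :
    ∫ x, S.mapCurrent ρ j x = S.sign • S.rot.symm (∫ x, j x) + (∫ x, ρ x) • S.boost := by
  simp only [mapCurrent]
  rw [integral_add (S.integrable_rot_symm hj) ((S.integrable_comp_pos hρ).smul_const _),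
    integral_smul, integral_smul_const, S.integral_comp_pos ρ]
  congr 2
  have h := S.rot.symm.toContinuousLinearEquiv.toContinuousLinearMap.integral_comp_comm
    (S.integrable_comp_pos hj)
  rw [S.integral_comp_pos j] at h
  exact h

/-- The transformed total current already contains κ∫ρ. Paired with the inverse boost this gives
-2|κ|²∫ρ, which overcomes the new square term |κ|²∫ρ. -/
theorem kineticShift_symm (hρ : Integrable ρ) (hj : Integrable j) :
    S.symm.kineticShift (S.mapDensity ρ) (S.mapCurrent ρ j) = -S.kineticShift ρ j := by
  have h1 : ∫ x, S.mapDensity ρ x = ∫ x, ρ x := S.integral_comp_pos ρ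
  have hs := S.sign_mul_self
  have h2 : ∀ v, inner ℝ S.symm.boost (S.symm.sign • S.symm.rot.symm v)
      = -inner ℝ S.boost v := fun v => by
    simp only [symm, LinearIsometryEquiv.symm_symm, inner_neg_left, inner_smul_left,
      inner_smul_right, LinearIsometryEquiv.inner_map_map, conj_trivial]
    linear_combination (-inner ℝ S.boost v) * hs
  have h3 : ‖S.symm.boost‖ ^ 2 = ‖S.boost‖ ^ 2 := by
    simp only [symm, norm_neg, norm_smul, LinearIsometryEquiv.norm_map, mul_pow, Real.norm_eq_abs,
      sq_abs, pow_two S.sign, hs, one_mul]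
  simp only [kineticShift]
  rw [h1, h2, h3, integral_mapCurrent S hρ hj, inner_add_right, inner_smul_right,
    inner_smul_right, real_inner_self_eq_norm_sq]
  ring

/-- Integrability of ρ provides the finite particle number that `FockState.map` requires. The energy
identity is written without subtraction. -/
theorem exists_state_map {Γ : FockState} (h : Γ.Represents ρ j) (hρ : ∀ x, 0 ≤ ρ x)
    (hρi : Integrable ρ) (hj : Integrable j) :
    ∃ Γ' : FockState, Γ'.Represents (S.mapDensity ρ) (S.mapCurrent ρ j) ∧
      Γ'.coulomb = Γ.coulomb ∧
      Γ'.kinetic + ENNReal.ofReal (-S.kineticShift ρ j)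
        = Γ.kinetic + ENNReal.ofReal (S.kineticShift ρ j) := by
  have hN : ∫⁻ x, Γ.density x = ENNReal.ofReal (∫ x, ρ x) := by
    rw [lintegral_congr_ae h.1, ofReal_integral_eq_lintegral_ofReal hρi
      (Filter.Eventually.of_forall hρ)]
  have hΓ : ∫⁻ x, Γ.density x ≠ ⊤ := by rw [hN]; exact ENNReal.ofReal_ne_top
  refine ⟨Γ.map S hΓ, h.map hρ S hΓ, Γ.coulomb_map S hΓ, ?_⟩
  have hk := Γ.toReal_kinetic_map S hΓ (hj.congr (h.2.mono fun x hx => hx.symm))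
  rw [integral_congr_ae h.2, hN, ENNReal.toReal_ofReal (integral_nonneg hρ)] at hk
  have hk' : (Γ.map S hΓ).kinetic.toReal = Γ.kinetic.toReal + S.kineticShift ρ j := hk
  have h1 : Γ.kinetic ≠ ⊤ := Γ.kinetic_ne_top
  have h2 : (Γ.map S hΓ).kinetic ≠ ⊤ := (Γ.map S hΓ).kinetic_ne_top
  rw [← ENNReal.toReal_eq_toReal_iff' (by finiteness) (by finiteness),
    ENNReal.toReal_add h2 (by finiteness), ENNReal.toReal_add h1 (by finiteness), hk']
  simp only [ENNReal.toReal_ofReal']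
  rcases le_total 0 (S.kineticShift ρ j) with hc | hc
  · rw [max_eq_left hc, max_eq_right (by linarith)]; ring
  · rw [max_eq_right hc, max_eq_left (by linarith)]; ring

/-- How a constrained minimum of the kinetic energy plus an invariant energy transforms. -/
theorem iInf_map_le {e : FockState → ℝ≥0∞}
    (he : ∀ Γ Γ' : FockState, Γ'.coulomb = Γ.coulomb → e Γ' = e Γ) (hρ : ∀ x, 0 ≤ ρ x)
    (hρi : Integrable ρ) (hj : Integrable j) :
    ((⨅ (Γ : FockState) (_ : Γ.Represents (S.mapDensity ρ) (S.mapCurrent ρ j)),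
        Γ.kinetic + e Γ : ℝ≥0∞) : EReal) ≤
      ((⨅ (Γ : FockState) (_ : Γ.Represents ρ j), Γ.kinetic + e Γ : ℝ≥0∞) : EReal)
        + (S.kineticShift ρ j : EReal) := by
  refine coe_ennreal_le_add_of_add_le ?_
  rw [← tsub_le_iff_right]
  refine le_iInf fun Γ => le_iInf fun h => ?_
  rw [tsub_le_iff_right]
  obtain ⟨Γ', h1, h2, h3⟩ := S.exists_state_map h hρ hρi hj
  calc _ ≤ Γ'.kinetic + e Γ' + ENNReal.ofReal (-S.kineticShift ρ j) := by
        gcongr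
        exact iInf₂_le Γ' h1
    _ = _ := by rw [add_right_comm, h3, add_right_comm, he Γ Γ' h2]

/-- The inequality for `S` and the one for its inverse, whose shift is the negative, give equality.
The choices `e = 0` and `e = coulomb` cover both functionals. -/
theorem iInf_map {e : FockState → ℝ≥0∞}
    (he : ∀ Γ Γ' : FockState, Γ'.coulomb = Γ.coulomb → e Γ' = e Γ) (hρ : ∀ x, 0 ≤ ρ x)
    (hρi : Integrable ρ) (hj : Integrable j) :
    ((⨅ (Γ : FockState) (_ : Γ.Represents (S.mapDensity ρ) (S.mapCurrent ρ j)),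
        Γ.kinetic + e Γ : ℝ≥0∞) : EReal) =
      ((⨅ (Γ : FockState) (_ : Γ.Represents ρ j), Γ.kinetic + e Γ : ℝ≥0∞) : EReal)
        + (S.kineticShift ρ j : EReal) := by
  refine le_antisymm (S.iInf_map_le he hρ hρi hj) ?_
  have h := S.symm.iInf_map_le (ρ := S.mapDensity ρ) (j := S.mapCurrent ρ j) he
    (fun x => hρ _) (S.integrable_comp_pos hρi) (S.integrable_mapCurrent hρi hj)
  rw [symm_mapDensity, symm_mapCurrent, S.kineticShift_symm hρi hj] at h
  have h2 := add_le_add_left h (S.kineticShift ρ j : EReal)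
  rwa [add_assoc, ← EReal.coe_add, neg_add_cancel, EReal.coe_zero, add_zero] at h2

theorem kineticEnergy_map (hρ : ∀ x, 0 ≤ ρ x) (hρi : Integrable ρ) (hj : Integrable j) :
    kineticEnergy (S.mapDensity ρ) (S.mapCurrent ρ j)
      = kineticEnergy ρ j + (S.kineticShift ρ j : EReal) := by
  have h := S.iInf_map (e := fun _ => 0) (fun _ _ _ => rfl) hρ hρi hj
  simp only [add_zero] at h
  exact h

theorem vignaleRasolt_map (hρ : ∀ x, 0 ≤ ρ x) (hρi : Integrable ρ) (hj : Integrable j) :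
    (vignaleRasolt (S.mapDensity ρ) (S.mapCurrent ρ j) : EReal)
      = (vignaleRasolt ρ j : EReal) + (S.kineticShift ρ j : EReal) :=
  S.iInf_map (e := fun Γ => Γ.coulomb) (fun _ _ h => h) hρ hρi hj

theorem directEnergy_map (ρ : E3 → ℝ) : directEnergy (S.mapDensity ρ) = directEnergy ρ := by
  unfold directEnergy mapDensity
  congr 1
  rw [← S.lintegral_comp_pos fun x => ∫⁻ y, ENNReal.ofReal (ρ x) * ENNReal.ofReal (ρ y) / edist x y]
  refine lintegral_congr fun x => ?_
  rw [← S.lintegral_comp_pos fun y =>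
    ENNReal.ofReal (ρ (S.pos x)) * ENNReal.ofReal (ρ y) / edist (S.pos x) y]
  refine lintegral_congr fun y => ?_
  congr 1
  simp [pos]

theorem indirectEnergy_map (hρ : ∀ x, 0 ≤ ρ x) (hρi : Integrable ρ) (hj : Integrable j) :
    indirectEnergy (S.mapDensity ρ) (S.mapCurrent ρ j)
      = indirectEnergy ρ j + (S.kineticShift ρ j : EReal) := by
  unfold indirectEnergy
  rw [S.vignaleRasolt_map hρ hρi hj, S.directEnergy_map, sub_eq_add_neg, sub_eq_add_neg,
    add_right_comm]

end WaveSymmetry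

/-! ### The cross product -/

/-- The cross product with a fixed vector. -/
def crossL (u : E3) : E3 →L[ℝ] E3 :=
  LinearMap.toContinuousLinearMap
    { toFun := cross u
      map_add' := fun v w => by simp [cross]
      map_smul' := fun c v => by simp [cross] }

theorem crossL_apply (u v : E3) : crossL u v = cross u v := rfl

theorem inner_cross (u v w : E3) :
    inner ℝ u (cross v w) = Matrix.det ![u.ofLp, v.ofLp, w.ofLp] := by
  rw [← triple_product_eq_det, PiLp.inner_apply, dotProduct]
  refine Finset.sum_congr rfl fun i _ => ?_
  simp [cross, mul_comm]

/-- The matrix of a rotation. -/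
def rotMatrix (R : E3 ≃ₗᵢ[ℝ] E3) : Matrix (Fin 3) (Fin 3) ℝ :=
  Matrix.of fun i k => R (EuclideanSpace.single k 1) i

theorem rotMatrix_mulVec (R : E3 ≃ₗᵢ[ℝ] E3) (u : E3) : (R u).ofLp = (rotMatrix R).mulVec u.ofLp := by
  have hu : u = ∑ k, u k • EuclideanSpace.single k (1 : ℝ) := by
    ext i
    simp [Fin.sum_univ_three]
    fin_cases i <;> simp
  conv_lhs => rw [hu]
  funext i
  simp [rotMatrix, Matrix.mulVec, dotProduct, Fin.sum_univ_three]
  ring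

theorem rotMatrix_det_sq (R : E3 ≃ₗᵢ[ℝ] E3) : (rotMatrix R).det * (rotMatrix R).det = 1 := by
  have h : (rotMatrix R).transpose * rotMatrix R = 1 := by
    ext i k
    have h1 : inner ℝ (R (EuclideanSpace.single i (1 : ℝ))) (R (EuclideanSpace.single k (1 : ℝ)))
        = inner ℝ (EuclideanSpace.single i (1 : ℝ)) (EuclideanSpace.single k (1 : ℝ)) :=
      R.inner_map_map _ _
    rw [EuclideanSpace.inner_single_left, PiLp.inner_apply] at h1
    rw [Matrix.mul_apply, Matrix.one_apply]
    simp only [map_one, one_mul, PiLp.single_apply] at h1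
    rw [← h1]
    refine Finset.sum_congr rfl fun l _ => ?_
    simp [rotMatrix, mul_comm]
  have h2 := congrArg Matrix.det h
  rwa [Matrix.det_mul, Matrix.det_transpose, Matrix.det_one] at h2

theorem det_rot (R : E3 ≃ₗᵢ[ℝ] E3) (u v w : E3) :
    Matrix.det ![(R u).ofLp, (R v).ofLp, (R w).ofLp]
      = (rotMatrix R).det * Matrix.det ![u.ofLp, v.ofLp, w.ofLp] := by
  have h : (![(R u).ofLp, (R v).ofLp, (R w).ofLp] : Matrix (Fin 3) (Fin 3) ℝ)
      = Matrix.of ![u.ofLp, v.ofLp, w.ofLp] * (rotMatrix R).transpose := by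
    ext i k
    rw [Matrix.mul_apply]
    fin_cases i <;>
      simp [rotMatrix_mulVec, Matrix.mulVec, dotProduct, mul_comm]
  rw [h, Matrix.det_mul, Matrix.det_transpose, mul_comm]
  rfl

/-- Paired with a vector R w, both sides are triple products, that is determinants, and R multiplies
a determinant by det R. -/
theorem cross_rot (R : E3 ≃ₗᵢ[ℝ] E3) (u v : E3) :
    cross (R u) (R v) = (rotMatrix R).det • R (cross u v) := by
  refine ext_inner_left ℝ fun w => ?_
  obtain ⟨w, rfl⟩ := R.surjective w
  rw [inner_cross, det_rot, ← inner_cross, inner_smul_right, LinearIsometryEquiv.inner_map_map]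

theorem norm_cross_rot (R : E3 ≃ₗᵢ[ℝ] E3) (u v : E3) : ‖cross (R u) (R v)‖ = ‖cross u v‖ := by
  have h := rotMatrix_det_sq R
  rw [cross_rot, norm_smul, LinearIsometryEquiv.norm_map, Real.norm_eq_abs]
  rcases mul_self_eq_one_iff.1 h with h | h <;> simp [h]

/-- Every Euclidean motion extends to a symmetry under which currents transform like vorticities
crossed with positions. -/
theorem exists_waveSymmetry (R : E3 ≃ₗᵢ[ℝ] E3) (a κ : E3) :
    ∃ S : WaveSymmetry, S.rot = R ∧ S.shift = a ∧ S.sign = (rotMatrix R).det ∧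
      S.boost = κ := by
  rcases mul_self_eq_one_iff.1 (rotMatrix_det_sq R) with h | h
  · exact ⟨⟨R, a, κ, RingHom.id ℂ, 1, Or.inl ⟨rfl, rfl⟩⟩, rfl, rfl, h.symm, rfl⟩
  -- An improper motion is accompanied by time reversal, which supplies the sign -1.
  · exact ⟨⟨R, a, κ, starRingEnd ℂ, -1, Or.inr ⟨rfl, rfl⟩⟩, rfl, rfl, h.symm, rfl⟩

/-! ### Smeared indicator functions -/

theorem integral_rescale_smul {η : E3 → ℝ} (h : ∫ x, η x • x = 0) {δ : ℝ} (hδ : 0 < δ) :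
    ∫ x, rescale η δ x • x = 0 := by
  have h1 := Measure.integral_comp_smul (volume : Measure E3)
    (fun y => ((δ ^ 3)⁻¹ * η y) • (δ • y)) δ⁻¹
  have h2 : ∀ x : E3, δ • δ⁻¹ • x = x := fun x => smul_inv_smul₀ hδ.ne' x
  simp only [h2] at h1
  have h3 : ∫ y : E3, ((δ ^ 3)⁻¹ * η y) • (δ • y) = 0 := by
    have : ∀ y : E3, ((δ ^ 3)⁻¹ * η y) • (δ • y) = ((δ ^ 3)⁻¹ * δ) • (η y • y) := fun y => by
      simp only [smul_smul]; ring_nf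
    simp only [this]
    rw [integral_smul, h, smul_zero]
  rw [h3, smul_zero] at h1
  exact h1

section Smeared

variable {Ω : Set E3} {ζ : E3 → ℝ}

theorem smeared_apply (x : E3) :
    smeared Ω ζ x = ∫ t, Ω.indicator (fun _ => (1 : ℝ)) t * ζ (x - t) := by
  simp [smeared, convolution]

theorem smeared_nonneg (hζ : ∀ x, 0 ≤ ζ x) (x : E3) : 0 ≤ smeared Ω ζ x := by
  rw [smeared_apply]
  exact integral_nonneg fun t =>
    mul_nonneg (Set.indicator_nonneg (fun _ _ => zero_le_one) t) (hζ _)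

/-- Differences of moved points see only the linear part of the motion, so the kernel is composed
with the rotation alone. -/
theorem smeared_motion (S : WaveSymmetry) (x : E3) :
    smeared (S.pos ⁻¹' Ω) (ζ ∘ S.rot) x = smeared Ω ζ (S.pos x) := by
  rw [smeared_apply, smeared_apply, ← S.integral_comp_pos fun t =>
    Ω.indicator (fun _ => (1 : ℝ)) t * ζ (S.pos x - t)]
  congr 1
  funext t
  have h1 : S.pos x - S.pos t = S.rot (x - t) := by simp [WaveSymmetry.pos]
  rw [h1]
  rfl

theorem integrable_indicator_one (ho : IsOpen Ω) (hb : Bornology.IsBounded Ω) :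
    Integrable (Ω.indicator fun _ => (1 : ℝ)) :=
  (integrable_indicator_iff ho.measurableSet).2 (integrableOn_const hb.measure_lt_top.ne)

theorem continuous_smeared (ho : IsOpen Ω) (hb : Bornology.IsBounded Ω) (hζ : Continuous ζ)
    (hc : HasCompactSupport ζ) : Continuous (smeared Ω ζ) :=
  hc.continuous_convolution_right _ (integrable_indicator_one ho hb).locallyIntegrable hζ

theorem hasCompactSupport_smeared (hb : Bornology.IsBounded Ω) (hc : HasCompactSupport ζ) :
    HasCompactSupport (smeared Ω ζ) := by
  refine HasCompactSupport.convolution _ ?_ hc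
  exact HasCompactSupport.of_support_subset_isCompact hb.isCompact_closure
    (Set.support_indicator_subset.trans subset_closure)

theorem integrable_smeared_smul {E : Type*} [NormedAddCommGroup E] [NormedSpace ℝ E]
    (ho : IsOpen Ω) (hb : Bornology.IsBounded Ω) (hζ : Continuous ζ)
    (hc : HasCompactSupport ζ) {f : E3 → E} (hf : Continuous f) :
    Integrable fun x => smeared Ω ζ x • f x :=
  ((continuous_smeared ho hb hζ hc).smul hf).integrable_of_hasCompactSupport
    (hasCompactSupport_smeared hb hc).smul_right

/-- The barycenter of a smeared domain. -/
theorem integral_smeared_smul (ho : IsOpen Ω) (hb : Bornology.IsBounded Ω) (hζ : Continuous ζ)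
    (hc : HasCompactSupport ζ) (hΩ : ∫ x in Ω, x = 0) (hζ0 : ∫ x, ζ x • x = 0) :
    ∫ x, smeared Ω ζ x • x = 0 := by
  set f : E3 → ℝ := Ω.indicator fun _ => (1 : ℝ) with hf
  have hfi : Integrable f := integrable_indicator_one ho hb
  let f₁ : E3 → E3 := Ω.indicator fun x => x
  let ζ₁ : E3 → E3 := fun x => ζ x • x
  have hζ₁ : Continuous ζ₁ := hζ.smul continuous_id
  have hζ₁c : HasCompactSupport ζ₁ := hc.smul_right
  have hf₁ : Integrable f₁ := by
    refine (integrable_indicator_iff ho.measurableSet).2 ?_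
    exact (continuous_id.locallyIntegrable.integrableOn_isCompact hb.isCompact_closure).mono_set
      subset_closure
  let L₁ : E3 →L[ℝ] ℝ →L[ℝ] E3 := (ContinuousLinearMap.lsmul ℝ ℝ).flip
  let L₂ : ℝ →L[ℝ] E3 →L[ℝ] E3 := ContinuousLinearMap.lsmul ℝ ℝ
  have e1 := hc.convolutionExists_right L₁ hf₁.locallyIntegrable hζ
  have e2 := hζ₁c.convolutionExists_right L₂ hfi.locallyIntegrable hζ₁
  -- Writing y = t + (y - t) splits the first moment into two convolutions, each with a factor of
  -- integral zero.
  have hsplit : ∀ y, smeared Ω ζ y • y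
      = convolution f₁ ζ L₁ volume y + convolution f ζ₁ L₂ volume y := by
    intro y
    rw [smeared_apply, ← integral_smul_const, convolution, convolution, ← integral_add (e1 y) (e2 y)]
    congr 1
    funext t
    by_cases ht : t ∈ Ω
    · simp [f₁, ζ₁, L₁, L₂, hf, ht, smul_sub]
    · simp [f₁, L₁, L₂, hf, ht]
  have hζi : Integrable ζ := hζ.integrable_of_hasCompactSupport hc
  have hζ₁i : Integrable ζ₁ := hζ₁.integrable_of_hasCompactSupport hζ₁c
  simp only [hsplit]
  rw [integral_add (hf₁.integrable_convolution L₁ hζi) (hfi.integrable_convolution L₂ hζ₁i),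
    integral_convolution L₁ hf₁ hζi, integral_convolution L₂ hfi hζ₁i]
  have h1 : ∫ x, f₁ x = 0 := by rw [integral_indicator ho.measurableSet, hΩ]
  have h2 : ∫ x, ζ₁ x = 0 := hζ0
  rw [h1, h2]
  simp

end Smeared

/-! ### Total current and gauge term of the smeared gas -/

section Gas

variable {Ω : Set E3} {ζ : E3 → ℝ} {ρ₀ : ℝ}

theorem integrable_uegDensity (ho : IsOpen Ω) (hb : Bornology.IsBounded Ω) (hζ : Continuous ζ)
    (hc : HasCompactSupport ζ) : Integrable (uegDensity Ω ζ ρ₀) :=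
  integrable_smeared_smul ho hb hζ hc (f := fun _ => ρ₀) continuous_const

theorem integrable_uegCurrent (ho : IsOpen Ω) (hb : Bornology.IsBounded Ω) (hζ : Continuous ζ)
    (hc : HasCompactSupport ζ) (ν : E3) : Integrable (uegCurrent Ω ζ ρ₀ ν) :=
  integrable_smeared_smul ho hb hζ hc (((crossL ν).continuous).const_smul (ρ₀ / 2))

/-- The total current is a linear image of the first moment of the smeared domain. -/
theorem integral_uegCurrent (ho : IsOpen Ω) (hb : Bornology.IsBounded Ω) (hζ : Continuous ζ)
    (hc : HasCompactSupport ζ) (h0 : ∫ x, smeared Ω ζ x • x = 0) (ν : E3) :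
    ∫ x, uegCurrent Ω ζ ρ₀ ν x = 0 := by
  have h : ∀ x, uegCurrent Ω ζ ρ₀ ν x = ((ρ₀ / 2) • crossL ν) (smeared Ω ζ x • x) := fun x => by
    simp only [uegCurrent, map_smul, smul_apply, crossL_apply]
  have hi : Integrable fun x => smeared Ω ζ x • x :=
    integrable_smeared_smul ho hb hζ hc continuous_id
  simp only [h]
  rw [ContinuousLinearMap.integral_comp_comm _ hi, h0, map_zero]

theorem gaugeTerm_ueg (ho : IsOpen Ω) (hb : Bornology.IsBounded Ω) (hζ : Continuous ζ)
    (hc : HasCompactSupport ζ) (hn : ∀ x, 0 ≤ ζ x) (hρ₀ : 0 ≤ ρ₀) (ν : E3) :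
    gaugeTerm (uegDensity Ω ζ ρ₀) (uegCurrent Ω ζ ρ₀ ν)
      = ENNReal.ofReal (∫ x, smeared Ω ζ x * (ρ₀ / 4 * ‖cross ν x‖ ^ 2)) := by
  have hcross : Continuous fun x => ρ₀ / 4 * ‖cross ν x‖ ^ 2 :=
    continuous_const.mul ((crossL ν).continuous.norm.pow 2)
  have hi : Integrable fun x => smeared Ω ζ x * (ρ₀ / 4 * ‖cross ν x‖ ^ 2) :=
    integrable_smeared_smul ho hb hζ hc hcross
  rw [ofReal_integral_eq_lintegral_ofReal hi
    (Filter.Eventually.of_forall fun x => mul_nonneg (smeared_nonneg hn x) (by positivity))]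
  refine lintegral_congr fun x => ?_
  have hs := smeared_nonneg (Ω := Ω) hn x
  -- Where the density vanishes the current vanishes too, and the quotient 0/0 counts as 0;
  -- elsewhere ordinary division applies.
  rcases eq_or_lt_of_le (mul_nonneg hs hρ₀) with h | h
  · have h1 : smeared Ω ζ x * (ρ₀ / 4 * ‖cross ν x‖ ^ 2) = 0 := by
      linear_combination (-(1 / 4) * ‖cross ν x‖ ^ 2) * h
    have h2 : uegCurrent Ω ζ ρ₀ ν x = 0 := by
      have : smeared Ω ζ x * (ρ₀ / 2) = 0 := by linear_combination (-(1 / 2)) * h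
      rw [uegCurrent, smul_smul, this, zero_smul]
    rw [h1, h2]
    simp
  · have h1 : ‖uegCurrent Ω ζ ρ₀ ν x‖ₑ ^ 2
        = ENNReal.ofReal ((smeared Ω ζ x * (ρ₀ / 2) * ‖cross ν x‖) ^ 2) := by
      rw [← ofReal_norm, ← ENNReal.ofReal_pow (norm_nonneg _), uegCurrent, norm_smul, norm_smul,
        Real.norm_of_nonneg hs, Real.norm_of_nonneg (by positivity), mul_assoc]
    rw [h1, uegDensity, ← ENNReal.ofReal_div_of_pos h]
    congr 1
    field_simp
    ring

/-- Parallel axis theorem: the cross term of the square is linear in x and vanishes with the first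
moment. -/
theorem gaugeTerm_integral_sub (ho : IsOpen Ω) (hb : Bornology.IsBounded Ω) (hζ : Continuous ζ)
    (hc : HasCompactSupport ζ) (h0 : ∫ x, smeared Ω ζ x • x = 0) (ν a : E3) :
    ∫ x, smeared Ω ζ x * (ρ₀ / 4 * ‖cross ν (x - a)‖ ^ 2)
      = (∫ x, smeared Ω ζ x * (ρ₀ / 4 * ‖cross ν x‖ ^ 2))
        + ρ₀ / 4 * ‖cross ν a‖ ^ 2 * ∫ x, smeared Ω ζ x := by
  have hcross : Continuous fun x => ρ₀ / 4 * ‖cross ν x‖ ^ 2 :=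
    continuous_const.mul ((crossL ν).continuous.norm.pow 2)
  let L : E3 →L[ℝ] ℝ := (-(ρ₀ / 2)) • (innerSL ℝ (cross ν a)).comp (crossL ν)
  have i1 : Integrable fun x => smeared Ω ζ x * (ρ₀ / 4 * ‖cross ν x‖ ^ 2) :=
    integrable_smeared_smul ho hb hζ hc hcross
  have i0 : Integrable fun x => smeared Ω ζ x • x :=
    integrable_smeared_smul ho hb hζ hc continuous_id
  have i2 : Integrable fun x => L (smeared Ω ζ x • x) := L.integrable_comp i0
  have i3 : Integrable fun x => smeared Ω ζ x * (ρ₀ / 4 * ‖cross ν a‖ ^ 2) :=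
    integrable_smeared_smul ho hb hζ hc continuous_const
  have i12 : Integrable fun x => smeared Ω ζ x * (ρ₀ / 4 * ‖cross ν x‖ ^ 2)
      + L (smeared Ω ζ x • x) := i1.add i2
  have h : ∀ x, smeared Ω ζ x * (ρ₀ / 4 * ‖cross ν (x - a)‖ ^ 2) =
      smeared Ω ζ x * (ρ₀ / 4 * ‖cross ν x‖ ^ 2) + L (smeared Ω ζ x • x)
        + smeared Ω ζ x * (ρ₀ / 4 * ‖cross ν a‖ ^ 2) := fun x => by
    have e1 : cross ν (x - a) = cross ν x - cross ν a := map_sub (crossL ν) x a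
    have e2 : L (smeared Ω ζ x • x)
        = -(ρ₀ / 2) * (smeared Ω ζ x * inner ℝ (cross ν x) (cross ν a)) := by
      simp only [L, map_smul, smul_apply, ContinuousLinearMap.comp_apply,
        crossL_apply, innerSL_apply_apply, smul_eq_mul, real_inner_comm]
      ring
    rw [e1, e2, norm_sub_sq_real]
    ring
  simp only [h]
  rw [integral_add i12 i3, integral_add i1 i2, L.integral_comp_comm i0, h0, map_zero, add_zero,
    integral_mul_const]
  ring

end Gas

/-- Only g and c have to be finite; the energy E may be infinite. -/
theorem ereal_add_sub_add (E : EReal) (g c : ℝ) :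
    E + (c : EReal) - ((g + c : ℝ) : EReal) = E - (g : EReal) := by
  induction E with
  | bot => simp
  | top => rw [EReal.top_add_coe, EReal.top_sub_coe, EReal.top_sub_coe]
  | coe r =>
    rw [← EReal.coe_add, ← EReal.coe_sub, ← EReal.coe_sub]
    congr 1
    ring

end MagneticUEG

end

/-! ### Behaviour of the energies under Euclidean motions -/

open MagneticUEG
theorem lemma3p5 (ρ₀ : ℝ) (hρ₀ : 0 ≤ ρ₀) (ν₀ : E3)
    (R : E3 ≃ₗᵢ[ℝ] E3) (a : E3) (T : E3 → E3) (hT : ∀ x, T x = R x + a)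
    (Ω : Set E3) (hΩ_open : IsOpen Ω) (hΩ_nonempty : Ω.Nonempty)
    (hΩ_bounded : Bornology.IsBounded Ω) (hΩ_barycenter : ∫ x in Ω, x = 0)
    (η : E3 → ℝ) (hη : IsRegularization η) (δ : ℝ) (hδ : 0 < δ) :
    -- (i)
    (indirectEnergy (uegDensity (T ⁻¹' Ω) (rescale η δ ∘ R) ρ₀)
        (uegCurrent (T ⁻¹' Ω) (rescale η δ ∘ R) ρ₀ ν₀) =
      indirectEnergy (uegDensity Ω (rescale η δ) ρ₀) (uegCurrent Ω (rescale η δ) ρ₀ (R ν₀)) +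
        ((ρ₀ / 4 * ‖cross (R ν₀) a‖ ^ 2 * ∫ x, smeared Ω (rescale η δ) x : ℝ) : EReal)) ∧
    (kineticEnergy (uegDensity (T ⁻¹' Ω) (rescale η δ ∘ R) ρ₀)
        (uegCurrent (T ⁻¹' Ω) (rescale η δ ∘ R) ρ₀ ν₀) =
      kineticEnergy (uegDensity Ω (rescale η δ) ρ₀) (uegCurrent Ω (rescale η δ) ρ₀ (R ν₀)) +
        ((ρ₀ / 4 * ‖cross (R ν₀) a‖ ^ 2 * ∫ x, smeared Ω (rescale η δ) x : ℝ) : EReal)) ∧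
    -- (ii)
    energyPerVolume (T ⁻¹' Ω) (rescale η δ ∘ R) ρ₀ ν₀ =
      energyPerVolume Ω (rescale η δ) ρ₀ (R ν₀) ∧
    kineticPerVolume (T ⁻¹' Ω) (rescale η δ ∘ R) ρ₀ ν₀ =
      kineticPerVolume Ω (rescale η δ) ρ₀ (R ν₀) ∧
    xcPerVolume (T ⁻¹' Ω) (rescale η δ ∘ R) ρ₀ ν₀ =
      xcPerVolume Ω (rescale η δ) ρ₀ (R ν₀) := by
  -- The boost is the one that cancels the constant current (ρ/2) Rν₀ × a after it has been rotated
  -- back and multiplied by det R.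
  obtain ⟨S, hR, ha, hs, hκ⟩ := exists_waveSymmetry R a
    (-((1 / 2 : ℝ) • (rotMatrix R).det • R.symm (cross (R ν₀) a)))
  have hTS : T = S.pos := funext fun x => by rw [hT, WaveSymmetry.pos, hR, ha]
  set ζ := rescale η δ
  have hn : ∀ x, 0 ≤ ζ x := fun x => mul_nonneg (by positivity) (hη.nonneg _)
  have hζ : Continuous ζ :=
    continuous_const.mul (hη.contDiff.continuous.comp (continuous_const_smul _))
  have hc : HasCompactSupport ζ :=
    (hη.hasCompactSupport.comp_smul (inv_ne_zero hδ.ne')).mul_left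
  have h0 : ∫ x, smeared Ω ζ x • x = 0 :=
    integral_smeared_smul hΩ_open hΩ_bounded hζ hc hΩ_barycenter
      (integral_rescale_smul hη.barycenter hδ)
  have hsm : ∀ x, smeared (T ⁻¹' Ω) (ζ ∘ R) x = smeared Ω ζ (S.pos x) := fun x => by
    rw [hTS, ← hR, smeared_motion]
  have hdet := rotMatrix_det_sq R
  have hρ : uegDensity (T ⁻¹' Ω) (ζ ∘ R) ρ₀ = S.mapDensity (uegDensity Ω ζ ρ₀) := by
    funext x
    rw [uegDensity, hsm]; rfl
  have hj : uegCurrent (T ⁻¹' Ω) (ζ ∘ R) ρ₀ ν₀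
      = S.mapCurrent (uegDensity Ω ζ ρ₀) (uegCurrent Ω ζ ρ₀ (R ν₀)) := by
    funext x
    have e1 : cross (R ν₀) (S.pos x) = (rotMatrix R).det • R (cross ν₀ x) + cross (R ν₀) a := by
      rw [← cross_rot, WaveSymmetry.pos, hR, ha]
      exact map_add (crossL (R ν₀)) _ _
    rw [WaveSymmetry.mapCurrent, uegCurrent, uegCurrent, uegDensity, hsm, e1, hκ, hs, hR]
    simp only [map_smul, map_add, LinearIsometryEquiv.symm_apply_apply]
    -- One determinant comes from `cross_rot`, the other from the sign of the symmetry; their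
    -- product 1 is inserted to match the two sides.
    have e2 : cross ν₀ x = ((rotMatrix R).det * (rotMatrix R).det) • cross ν₀ x := by
      rw [hdet, one_smul]
    conv_lhs => rw [e2]
    module
  -- The total current is zero, so only |κ|²∫ρ is left; the factor 1/4 is the square of the 1/2 in
  -- the boost.
  have hshift : S.kineticShift (uegDensity Ω ζ ρ₀) (uegCurrent Ω ζ ρ₀ (R ν₀))
      = ρ₀ / 4 * ‖cross (R ν₀) a‖ ^ 2 * ∫ x, smeared Ω ζ x := by
    rw [WaveSymmetry.kineticShift, integral_uegCurrent hΩ_open hΩ_bounded hζ hc h0, hκ]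
    simp only [map_zero, smul_zero, inner_zero_right, mul_zero, zero_add, uegDensity]
    rw [integral_mul_const, norm_neg, norm_smul, norm_smul, LinearIsometryEquiv.norm_map,
      mul_pow, mul_pow, Real.norm_eq_abs, Real.norm_eq_abs, sq_abs, sq_abs,
      pow_two (rotMatrix R).det, hdet]
    ring
  have hρ0 : ∀ x, 0 ≤ uegDensity Ω ζ ρ₀ x := fun x => mul_nonneg (smeared_nonneg hn x) hρ₀
  have hρi := integrable_uegDensity (ρ₀ := ρ₀) hΩ_open hΩ_bounded hζ hc
  have hji := integrable_uegCurrent (ρ₀ := ρ₀) hΩ_open hΩ_bounded hζ hc (R ν₀)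
  have hE := S.indirectEnergy_map hρ0 hρi hji
  have hK := S.kineticEnergy_map hρ0 hρi hji
  rw [← hρ, ← hj, hshift] at hE hK
  -- With y = Rx + a one has |ν₀ × x| = |Rν₀ × (y - a)|, so the parallel axis theorem yields the
  -- same constant as in (i).
  have hgauge : (gaugeTerm (uegDensity (T ⁻¹' Ω) (ζ ∘ R) ρ₀)
      (uegCurrent (T ⁻¹' Ω) (ζ ∘ R) ρ₀ ν₀) : EReal)
      = (((∫ x, smeared Ω ζ x * (ρ₀ / 4 * ‖cross (R ν₀) x‖ ^ 2))
        + ρ₀ / 4 * ‖cross (R ν₀) a‖ ^ 2 * ∫ x, smeared Ω ζ x : ℝ) : EReal) := by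
    have ho' : IsOpen (T ⁻¹' Ω) := by
      rw [hTS]; exact hΩ_open.preimage (S.rot.continuous.add continuous_const)
    have hb' : Bornology.IsBounded (T ⁻¹' Ω) := by
      have hi : Isometry T := by
        rw [hTS]
        exact Isometry.of_dist_eq fun x y => by simp [WaveSymmetry.pos]
      exact hi.antilipschitz.isBounded_preimage hΩ_bounded
    rw [gaugeTerm_ueg ho' hb' (hζ.comp R.continuous)
      (hc.comp_homeomorph R.toHomeomorph) (fun x => hn _) hρ₀, EReal.coe_ennreal_ofReal,
      max_eq_left (integral_nonneg fun x => mul_nonneg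
        (smeared_nonneg (fun x => hn _) x) (by positivity)),
      ← gaugeTerm_integral_sub hΩ_open hΩ_bounded hζ hc h0, ← S.integral_comp_pos fun x =>
        smeared Ω ζ x * (ρ₀ / 4 * ‖cross (R ν₀) (x - a)‖ ^ 2)]
    congr 2
    funext x
    rw [hsm, WaveSymmetry.pos, ha, add_sub_cancel_right, hR, norm_cross_rot]
  have hgauge' : (gaugeTerm (uegDensity Ω ζ ρ₀) (uegCurrent Ω ζ ρ₀ (R ν₀)) : EReal)
      = ((∫ x, smeared Ω ζ x * (ρ₀ / 4 * ‖cross (R ν₀) x‖ ^ 2) : ℝ) : EReal) := by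
    rw [gaugeTerm_ueg hΩ_open hΩ_bounded hζ hc hn hρ₀, EReal.coe_ennreal_ofReal,
      max_eq_left (integral_nonneg fun x => mul_nonneg (smeared_nonneg hn x) (by positivity))]
  have hvol : volume (T ⁻¹' Ω) = volume Ω := by
    rw [hTS]; exact S.measurePreserving_pos.measure_preimage hΩ_open.nullMeasurableSet
  have he : energyPerVolume (T ⁻¹' Ω) (ζ ∘ R) ρ₀ ν₀ = energyPerVolume Ω ζ ρ₀ (R ν₀) := by
    rw [energyPerVolume, energyPerVolume, gaugeCorrectedEnergy, gaugeCorrectedEnergy, hE, hgauge,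
      hgauge', ereal_add_sub_add, hvol]
  have hτ : kineticPerVolume (T ⁻¹' Ω) (ζ ∘ R) ρ₀ ν₀ = kineticPerVolume Ω ζ ρ₀ (R ν₀) := by
    rw [kineticPerVolume, kineticPerVolume, gaugeCorrectedKinetic, gaugeCorrectedKinetic, hK,
      hgauge, hgauge', ereal_add_sub_add, hvol]
  exact ⟨hE, hK, he, hτ, by rw [xcPerVolume, xcPerVolume, he, hτ]⟩
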